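/- Identify a point $d=[d_0:d_1:d_2]$ of the dual plane $\check{\mathbb P}^2$ with the complex projective line $\{d_0z_0+d_1z_1+d_2z_2=0\}$ of $\mathbb P^2=\mathbb P^2(\mathbb C)$, and $\check{\check{\mathbb P}}^2$ with $\mathbb P^2$. For a real subset $N$ of $\mathbb P^2$ or of $\check{\mathbb P}^2$ with real tangent spaces $T_zN$ (spanned by the velocities at $z$ of curves in $N$), a complex line $d$ is called critical at $z\in N$ if $z\in d$ and $T_zd+T_zN\neq T_z\mathbb P^2$; the dual $\check N$ is the set of all complex lines that are critical at some point of $N$. If $N$ is a surface and $T_zN$ is not complex, the critical lines at $z$ form a circle, the critical circle. A critical line $d$ of a $C^2$ real surface $S$ at $z$ is called exceptional if there is a regular $C^2$ curve in $S$ through $z$, tangent to $d$ at $z$, whose curvature vector (second derivative in an affine chart) at $z$ lies in the direction of $d$. The germ at $d$ of the dual of a germ $(N,z)$ is a set germ $(H,d)$ such that, for every sufficiently small open neighbourhood $U$ of $z$, the sets $(N\cap U)^{\vee}$ and $H$ coincide near $d$. **Lemma.** Let $(S,z_0)$ be a germ of smooth real surface of class $C^2$ in $\mathbb P^2$ whose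 tangent plane $T_{z_0}S$ is not complex, and let $d_0$ be a non-exceptional complex line in the critical circle of $S$ at $z_0$. Then the germ $(\check S,d_0)$ of the dual is well defined and is a germ of smooth real hypersurface (real dimension $3$) of class $C^1$ of $\check{\mathbb P}^2$; the germ at $z_0$ of the dual of $(\check S,d_0)$ is well defined, and it is equal to $(S,z_0)$: $\check{\check S}=S$. In particular, two such surface germs cannot have the same dual: if $(S,z_0)$ and $(S',z_0')$ both satisfy the hypotheses with the same line $d_0$, and $(\check S,d_0)=(\check S',d_0)$, then $z_0=z_0'$ and $(S,z_0)=(S',z_0')$. -/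

import Mathlib

open Filter Topology
open scoped Matrix

namespace RealDuality

/-- The complex vector space `ℂ³` of homogeneous coordinates. -/
abbrev V : Type := Fin 3 → ℂ

/-- The complex projective plane. A point `d` of it also stands for the complex projective line
`{z | d₀ z₀ + d₁ z₁ + d₂ z₂ = 0}`, so that the same type is used for the plane `ℙ²` and for the
dual plane `ℙ̌²` (with dual homogeneous coordinates), and the dual of `ℙ̌²` is `ℙ²` itself. -/
abbrev P2 : Type := Projectivization ℂ V

/-- The quotient topology of the projective plane. -/
noncomputable instance : TopologicalSpace P2 :=
  TopologicalSpace.coinduced (Projectivization.mk' ℂ) inferInstance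

/-- The set of all homogeneous coordinate vectors of the points of `N`. -/
def cone (N : Set P2) : Set V := {v | ∃ hv : v ≠ 0, Projectivization.mk ℂ v hv ∈ N}

/-- The `2`-dimensional linear subspace of `ℂ³` whose projectivization is the complex line with
dual coordinates `d`. -/
def lineSpace (d : P2) : Submodule ℂ V where
  carrier := {w | ∀ a ∈ d.submodule, a ⬝ᵥ w = 0}
  zero_mem' := by intro a _; simp
  add_mem' := by
    intro x y hx hy a ha
    rw [dotProduct_add, hx a ha, hy a ha, add_zero]
  smul_mem' := by
    intro c x hx a ha
    rw [dotProduct_smul, hx a ha, smul_zero]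

/-- The real subset `N` of `ℙ²` is, near `z`, a smooth (that is, nonsingular, embedded) real
submanifold of class `C^k` (`k ≥ 1`) and of real dimension `m`: a neighbourhood of `z` in `N` has
a `C^k` parametrization `u ↦ [φ u]`, `φ` with values in `ℂ³ ∖ {0}`, which is an immersion at `0`
(recall that `T_{[v]} ℙ² = ℂ³ / ℂ v`) and a homeomorphism onto its image. The last equation says
that the neighbourhoods of `z` in `N` correspond to the neighbourhoods of `0` in `ℝᵐ`. -/
def IsSubmanifoldAt (k m : ℕ) (N : Set P2) (z : P2) : Prop :=
  ∃ (φ : EuclideanSpace ℝ (Fin m) → V) (hφ : ∀ u, φ u ≠ 0),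
    ContDiffAt ℝ k φ 0 ∧
    (∀ w, fderiv ℝ φ 0 w ∈ Submodule.span ℂ {φ 0} → w = 0) ∧
    Projectivization.mk ℂ (φ 0) (hφ 0) = z ∧
    map (fun u => Projectivization.mk ℂ (φ u) (hφ u)) (𝓝 0) = 𝓝[N] z

/-- The real tangent space of `N` at `z`, in homogeneous coordinates: the real subspace of `ℂ³`
generated by the velocities at `v = z.rep` of the curves in the cone over `N`. For a submanifold
it is the preimage of `T_z N ⊆ T_z ℙ² = ℂ³ / ℂ v` in `ℂ³`; in particular it contains `ℂ v`. -/
noncomputable def tangentLift (N : Set P2) (z : P2) : Submodule ℝ V :=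
  Submodule.span ℝ {w | ∃ γ : ℝ → V, γ 0 = z.rep ∧ HasDerivAt γ w 0 ∧
    ∀ᶠ t in 𝓝 (0 : ℝ), γ t ∈ cone N}

/-- The real tangent space of `N` at `z` is a complex subspace of `T_z ℙ²`. -/
def HasComplexTangent (N : Set P2) (z : P2) : Prop :=
  ∃ W : Submodule ℂ V, W.restrictScalars ℝ = tangentLift N z

/-- The complex line `d` passes through `z ∈ N` and is not transverse to `N` there:
`T_z d + T_z N ≠ T_z ℙ²`. For fixed `z` in a surface `N` with non-complex tangent plane at `z`,
the set of these lines `d` is the critical circle. For fixed `N`, the pairs `(z, d)` form the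
lift `p^* N ⊆ ℙ(T ℙ²) = {(z, d) | z ∈ d}`. -/
def IsCritical (N : Set P2) (z d : P2) : Prop :=
  z ∈ N ∧ z.rep ∈ lineSpace d ∧ (lineSpace d).restrictScalars ℝ ⊔ tangentLift N z ≠ ⊤

/-- The dual `Ň` of `N`: the set of the complex lines that are not transverse to `N` at some
point of `N`, that is, the projection of `p^* N` to the dual plane. -/
def dual (N : Set P2) : Set P2 := {d | ∃ z, IsCritical N z d}

/-- The critical line `d` of the surface `S` at `z` is exceptional: there is a regular `C²` curve
`[γ]` in `S` through `z`, tangent to `d` at `z`, whose curvature vector at `z` is in the direction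
of `d`. In homogeneous coordinates, `γ''(0)` lies in the plane of `d`; this does not depend on the
lift `γ` of the curve to `ℂ³`, as `γ(0)` and `γ'(0)` lie in that plane. In an affine chart,
with `γ = (1, c)`, it says that `c''(0)` is in the direction of `d`. -/
def IsExceptional (S : Set P2) (z d : P2) : Prop :=
  IsCritical S z d ∧
  ∃ γ : ℝ → V, ContDiffAt ℝ 2 γ 0 ∧ (∀ᶠ t in 𝓝 (0 : ℝ), γ t ∈ cone S) ∧
    γ 0 ∈ z.submodule ∧ deriv γ 0 ∉ Submodule.span ℂ {γ 0} ∧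
    deriv γ 0 ∈ lineSpace d ∧ iteratedDeriv 2 γ 0 ∈ lineSpace d

/-- The set `M` represents the germ at `d` of the dual of the germ `(N, z)`: for every
sufficiently small open neighbourhood `U` of `z`, the sets `dual (N ∩ U)` and `M` coincide near
`d`. -/
def IsDualGerm (N : Set P2) (z d : P2) (M : Set P2) : Prop :=
  ∃ U₀ ∈ 𝓝 z, ∀ U ⊆ U₀, IsOpen U → z ∈ U →
    ∀ᶠ x in 𝓝 d, (x ∈ dual (N ∩ U) ↔ x ∈ M)

/-- `(S, z)` is a germ of smooth real surface of class `C²` whose tangent plane at `z` is not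
complex, and `d` is a non-exceptional complex line of its critical circle at `z`. -/
structure IsRegularPair (S : Set P2) (z d : P2) : Prop where
  surface : IsSubmanifoldAt 2 2 S z
  not_complex : ¬ HasComplexTangent S z
  critical : IsCritical S z d
  not_exceptional : ¬ IsExceptional S z d

end RealDuality

namespace RealDuality

/-! Write `S` near `z₀` as `[φ u]` with `u` in a real plane. A complex line through `[φ u]` is
critical exactly when it contains a real tangent direction of `S`. If `w₀` is the direction tangent
to `d₀` and `w₁` completes it to a basis, the critical lines near `d₀` are therefore `ψ(u, σ) = φ(u)
× dφ_u(w₀ + σ w₁)` with `σ` real (`dualParam`), a `C¹` map of three real variables.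

Let `D = det(φ, dφ w₀, dφ w₁)` (`frameDet`); it is nonzero because the tangent plane is not complex.
The map `ψ` is a projective immersion at `0`: pairing `dψ(α w₀ + β w₁, s) ∈ ℂ ψ` with `φ` forces `β
= 0`. What remains says that `α φ''(w₀, w₀) + s dφ w₁` lies in the plane of `d₀`. If `α ≠ 0` this
produces a curve making `d₀` exceptional; if `α = 0` then `s D = 0`, so `s = 0`
(`dualParam_immersion`). Thus the dual is a `C¹` hypersurface `H`.

Biduality rests on `φ · dψ(α w₀ + β w₁, s) = (α σ - β) D`, a real multiple of `D`: the line with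
coordinates `φ(u)` is critical for `H` at `ψ(u, σ)`. A real hypersurface has only one critical
complex line at each point (`IsConormal.exists_smul`), so the dual of `H` near `z₀` is again `{[φ
u]}`, that is `S`. In particular `z₀` is the only critical line of `H` at `d₀`, so the germ of `H`
determines both `z₀` and the germ of `S`. -/

/-! ### Cones and the topology of the projective plane -/

theorem mem_cone_iff {N : Set P2} {v : V} (hv : v ≠ 0) :
    v ∈ cone N ↔ Projectivization.mk ℂ v hv ∈ N :=
  ⟨fun ⟨_, h⟩ => h, fun h => ⟨hv, h⟩⟩

theorem ne_zero_of_mem_cone {N : Set P2} {v : V} (h : v ∈ cone N) : v ≠ 0 := h.1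

theorem rep_mem_cone_iff {N : Set P2} {x : P2} : x.rep ∈ cone N ↔ x ∈ N := by
  rw [mem_cone_iff x.rep_nonzero, Projectivization.mk_rep]

theorem cone_mono {M N : Set P2} (h : M ⊆ N) : cone M ⊆ cone N :=
  fun _ ⟨hv, hm⟩ => ⟨hv, h hm⟩

theorem mem_cone_inter {M N : Set P2} {v : V} : v ∈ cone (M ∩ N) ↔ v ∈ cone M ∧ v ∈ cone N :=
  ⟨fun ⟨hv, h⟩ => ⟨⟨hv, h.1⟩, ⟨hv, h.2⟩⟩, fun ⟨⟨hv, h⟩, ⟨_, h'⟩⟩ => ⟨hv, h, h'⟩⟩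

theorem smul_mem_cone_iff {N : Set P2} {v : V} {c : ℂ} (hc : c ≠ 0) :
    c • v ∈ cone N ↔ v ∈ cone N := by
  by_cases hv : v = 0
  · simp [hv, cone]
  · have hcv : c • v ≠ 0 := smul_ne_zero hc hv
    rw [mem_cone_iff hv, mem_cone_iff hcv]
    have : Projectivization.mk ℂ (c • v) hcv = Projectivization.mk ℂ v hv :=
      (Projectivization.mk_eq_mk_iff' ..).2 ⟨c, rfl⟩
    rw [this]

theorem exists_smul_of_mem_cone_singleton {v w : V} {x : P2} (hv : v ∈ cone {x})
    (hw : w ∈ cone {x}) : ∃ c : ℂ, c ≠ 0 ∧ v = c • w := by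
  obtain ⟨hv, rfl⟩ := hv
  obtain ⟨hw, h⟩ := hw
  obtain ⟨c, hc⟩ := (Projectivization.mk_eq_mk_iff' ..).1 h.symm
  refine ⟨c, ?_, hc.symm⟩
  rintro rfl
  exact hv (by rw [← hc, zero_smul])

theorem mem_iff_of_mem_cone_singleton {v : V} {x : P2} {N : Set P2} (hv : v ∈ cone {x}) :
    v ∈ cone N ↔ x ∈ N := by
  obtain ⟨hv, rfl⟩ := hv
  exact mem_cone_iff hv

theorem isOpen_cone {U : Set P2} (hU : IsOpen U) : IsOpen (cone U) := by
  have h : cone U = Subtype.val '' (Projectivization.mk' ℂ ⁻¹' U : Set {v : V // v ≠ 0}) := by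
    ext v
    constructor
    · rintro ⟨hv, h⟩
      exact ⟨⟨v, hv⟩, h, rfl⟩
    · rintro ⟨⟨v, hv⟩, h, rfl⟩
      exact ⟨hv, h⟩
  rw [h]
  exact (isOpen_compl_singleton (x := (0 : V))).isOpenMap_subtype_val _
    (hU.preimage continuous_coinduced_rng)

/-- The points of the projective plane having homogeneous coordinates in `O`. -/
def proj (O : Set V) : Set P2 := {x | ∃ v ∈ O, v ∈ cone {x}}

theorem isOpen_proj {O : Set V} (hO : IsOpen O) : IsOpen (proj O) := by
  refine isOpen_coinduced.2 ?_
  have h : (Projectivization.mk' ℂ ⁻¹' proj O : Set {v : V // v ≠ 0}) =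
      ⋃ (c : ℂ) (_ : c ≠ 0), {v : {v : V // v ≠ 0} | c • (v : V) ∈ O} := by
    ext ⟨v, hv⟩
    simp only [Set.mem_preimage, Set.mem_iUnion, Set.mem_ofPred_eq, exists_prop]
    have hvv : v ∈ cone {Projectivization.mk' ℂ ⟨v, hv⟩} := ⟨hv, rfl⟩
    constructor
    · rintro ⟨w, hw, hwv⟩
      obtain ⟨c, hc, rfl⟩ := exists_smul_of_mem_cone_singleton hwv hvv
      exact ⟨c, hc, hw⟩
    · rintro ⟨c, hc, h⟩
      exact ⟨c • v, h, (smul_mem_cone_iff hc).2 hvv⟩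
  rw [h]
  refine isOpen_iUnion fun c => isOpen_iUnion fun _ => ?_
  exact hO.preimage (continuous_subtype_val.const_smul c)

theorem mem_cone_proj {O : Set V} {v : V} (hv : v ≠ 0) (h : v ∈ O) : v ∈ cone (proj O) :=
  ⟨hv, v, h, hv, rfl⟩

theorem exists_smul_mem_of_mem_cone_proj {O : Set V} {v : V} (h : v ∈ cone (proj O)) :
    ∃ c : ℂ, c ≠ 0 ∧ c • v ∈ O := by
  obtain ⟨hv, w, hw, hwv⟩ := h
  obtain ⟨c, hc, rfl⟩ := exists_smul_of_mem_cone_singleton hwv ⟨hv, rfl⟩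
  exact ⟨c, hc, hw⟩

/-- The quotient map is continuous and open, so local statements on the projective plane can be
tested on homogeneous coordinates. -/
theorem eventually_nhds_iff_cone {v : V} {x : P2} (hv : v ∈ cone {x}) {p : P2 → Prop} :
    (∀ᶠ y in 𝓝 x, p y) ↔ ∀ᶠ w in 𝓝 v, w ∈ cone {y | p y} := by
  constructor
  · intro h
    obtain ⟨U, hUp, hU, hxU⟩ := eventually_nhds_iff.1 h |>.imp fun _ h => h
    filter_upwards [(isOpen_cone hU).mem_nhds ((mem_iff_of_mem_cone_singleton hv).2 hxU)] with w hw
    exact cone_mono hUp hw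
  · intro h
    obtain ⟨O, hOp, hO, hvO⟩ := eventually_nhds_iff.1 h
    have hxO : x ∈ proj O := ⟨v, hvO, hv⟩
    filter_upwards [(isOpen_proj hO).mem_nhds hxO]
    rintro y ⟨w, hw, hwy⟩
    exact (mem_iff_of_mem_cone_singleton hwy).1 (hOp w hw)

theorem mem_lineSpace_iff {a w : V} {d : P2} (ha : a ∈ cone {d}) :
    w ∈ lineSpace d ↔ a ⬝ᵥ w = 0 := by
  obtain ⟨ha, rfl⟩ := ha
  change (∀ b ∈ (Projectivization.mk ℂ a ha).submodule, b ⬝ᵥ w = 0) ↔ _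
  rw [Projectivization.submodule_mk]
  constructor
  · exact fun h => h a (Submodule.mem_span_singleton_self a)
  · intro h b hb
    obtain ⟨c, rfl⟩ := Submodule.mem_span_singleton.1 hb
    rw [smul_dotProduct, h, smul_zero]

/-! ### Local parametrizations and tangent spaces -/

section

variable {E : Type*} [NormedAddCommGroup E] [NormedSpace ℝ E]

theorem exists_continuousLinearMap_eq_one {v : V} (hv : v ≠ 0) : ∃ l : V →L[ℂ] ℂ, l v = 1 := by
  obtain ⟨i, hi⟩ := Function.ne_iff.1 hv
  refine ⟨(v i)⁻¹ • ContinuousLinearMap.proj i, ?_⟩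
  simpa using inv_mul_cancel₀ hi

theorem differentiableAt_inv_smul {l : V →L[ℂ] ℂ} {v : V} (hv : l v ≠ 0) :
    DifferentiableAt ℝ (fun w => (l w)⁻¹ • w) v := by
  have h : DifferentiableAt ℝ (fun w : V => l w) v :=
    (l.restrictScalars ℝ).differentiableAt
  exact (h.inv hv).smul differentiableAt_id

/-- A projective immersion has a homogeneous differentiable local left inverse. -/
theorem exists_homogeneous_leftInverse [FiniteDimensional ℝ E] {φ : E → V} (h0 : φ 0 ≠ 0)
    (hφ : ContDiffAt ℝ 1 φ 0)
    (himm : ∀ (w : E) (c : ℂ), fderiv ℝ φ 0 w = c • φ 0 → w = 0) :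
    ∃ (l : V →L[ℂ] ℂ) (g : V → E), ∀ᶠ u in 𝓝 0, l (φ u) ≠ 0 ∧
      ∀ c : ℂ, c ≠ 0 → g (c • φ u) = u ∧ DifferentiableAt ℝ g (c • φ u) := by
  obtain ⟨l, hl⟩ := exists_continuousLinearMap_eq_one h0
  have hd : HasFDerivAt φ (fderiv ℝ φ 0) 0 := (hφ.differentiableAt one_ne_zero).hasFDerivAt
  have hlφ : HasFDerivAt (fun u => l (φ u)) ((l.restrictScalars ℝ).comp (fderiv ℝ φ 0)) 0 :=
    (l.restrictScalars ℝ).hasFDerivAt.comp 0 hd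
  have hlc : ContDiffAt ℝ 1 (fun u => l (φ u)) 0 :=
    (l.restrictScalars ℝ).contDiff.contDiffAt.comp 0 hφ
  set f : E → V := fun u => (l (φ u))⁻¹ • φ u with hf
  have hfc : ContDiffAt ℝ 1 f 0 := (hlc.inv (by rw [hl]; exact one_ne_zero)).smul hφ
  have hfd : HasFDerivAt f (fderiv ℝ f 0) 0 := (hfc.differentiableAt one_ne_zero).hasFDerivAt
  -- `f` is the lift normalized by `l = 1`. Differentiating `φ = l(φ) • f` turns injectivity modulo
  -- `ℂ φ 0` into injectivity of `df`.
  have hker : LinearMap.ker (fderiv ℝ f 0 : E →ₗ[ℝ] V) = ⊥ := by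
    refine LinearMap.ker_eq_bot'.2 fun w hw => ?_
    have h1 : HasFDerivAt (fun u => l (φ u) • f u) (fderiv ℝ φ 0) 0 := by
      refine hd.congr_of_eventuallyEq ?_
      have : ∀ᶠ u in 𝓝 (0 : E), l (φ u) ≠ 0 :=
        hlφ.continuousAt.eventually_ne (by rw [hl]; exact one_ne_zero)
      filter_upwards [this] with u hu
      simp [hf, smul_smul, hu]
    have h2 := (h1.unique (hlφ.smul hfd))
    have h3 := congrArg (fun A : E →L[ℝ] V => A w) h2
    have hw' : fderiv ℝ f 0 w = 0 := hw
    refine himm w (l (fderiv ℝ φ 0 w)) ?_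
    have hf0 : f 0 = φ 0 := by simp [hf, hl]
    refine h3.trans ?_
    rw [add_apply, smul_apply, hw', smul_zero, zero_add,
      ContinuousLinearMap.smulRight_apply, hf0]
    rfl
  -- `L ∘ f` has derivative the identity, so the inverse function theorem applies. Precomposing its
  -- local inverse with `v ↦ v / l v` makes the result invariant under complex scaling.
  obtain ⟨L, hL⟩ := LinearMap.exists_leftInverse_of_injective _ hker
  let L' : V →L[ℝ] E := L.toContinuousLinearMap
  have hFc : ContDiffAt ℝ 1 (fun u => L' (f u)) 0 := L'.contDiff.contDiffAt.comp 0 hfc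
  have hFd : HasFDerivAt (fun u => L' (f u))
      ((ContinuousLinearEquiv.refl ℝ E : E ≃L[ℝ] E) : E →L[ℝ] E) 0 := by
    have := L'.hasFDerivAt.comp (0 : E) hfd
    have hLid : L'.comp (fderiv ℝ f 0) =
        ((ContinuousLinearEquiv.refl ℝ E : E ≃L[ℝ] E) : E →L[ℝ] E) :=
      ContinuousLinearMap.ext fun w => LinearMap.congr_fun hL w
    rwa [hLid] at this
  have hle := (hFc.hasStrictFDerivAt' hFd one_ne_zero).eventually_left_inverse
  have hlocal : ∀ᶠ y in 𝓝 (L' (f 0)), ContDiffAt ℝ 1 (hFc.localInverse hFd one_ne_zero) y :=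
    (hFc.to_localInverse hFd one_ne_zero).eventually (by decide)
  refine ⟨l, fun v => hFc.localInverse hFd one_ne_zero (L' ((l v)⁻¹ • v)), ?_⟩
  filter_upwards [hle, hFc.continuousAt.eventually hlocal,
    hlφ.continuousAt.eventually_ne (y := 0) (by rw [hl]; exact one_ne_zero)] with u h1 h2 (h3 : l (φ u) ≠ 0)
  refine ⟨h3, fun c hc => ?_⟩
  have hcu : (l (c • φ u))⁻¹ • c • φ u = f u := by
    simp only [hf, map_smul, smul_eq_mul, smul_smul]
    congr 1
    field_simp
  refine ⟨?_, ?_⟩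
  · rw [hcu]
    exact h1
  · have h4 : DifferentiableAt ℝ (fun w : V => (l w)⁻¹ • w) (c • φ u) :=
      differentiableAt_inv_smul (by simp [hc, h3])
    refine DifferentiableAt.comp (g := hFc.localInverse hFd one_ne_zero) (c • φ u) ?_
      (L'.differentiableAt.comp (c • φ u) h4)
    change DifferentiableAt ℝ _ (L' _)
    rw [hcu]
    exact h2.differentiableAt one_ne_zero

/-- The complex line with dual coordinates `b` is critical at `[φ u]` for the submanifold
parametrized by `φ`. -/
def IsConormal (φ : E → V) (u : E) (b : V) : Prop :=
  b ⬝ᵥ φ u = 0 ∧ ∃ θ : ℂ, θ ≠ 0 ∧ ∀ w, (θ * (b ⬝ᵥ fderiv ℝ φ u w)).re = 0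

/-- Near `[φ u]`, the set `N` is parametrized by the projective immersion `φ`, with a
differentiable left inverse `g`. -/
structure IsParamAt (φ : E → V) (N : Set P2) (u : E) : Prop where
  diff : DifferentiableAt ℝ φ u
  imm : ∀ (w : E) (c : ℂ), fderiv ℝ φ u w = c • φ u → w = 0
  mem : ∀ᶠ u' in 𝓝 u, φ u' ∈ cone N
  inv : ∃ (l : V →L[ℂ] ℂ) (g : V → E), l (φ u) ≠ 0 ∧ g (φ u) = u ∧ DifferentiableAt ℝ g (φ u) ∧
    ∀ᶠ v in 𝓝 (φ u), v ∈ cone N → l (φ (g v)) • v = l v • φ (g v)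

/-- The germ of `N` at `[φ 0]` is a submanifold parametrized by `φ`. -/
structure LocalParam (φ : E → V) (N : Set P2) : Prop where
  contDiff : ContDiffAt ℝ 1 φ 0
  imm : ∀ (w : E) (c : ℂ), fderiv ℝ φ 0 w = c • φ 0 → w = 0
  mem : ∀ᶠ u in 𝓝 0, φ u ∈ cone N
  surj : ∀ A ∈ 𝓝 (0 : E), ∀ᶠ v in 𝓝 (φ 0), v ∈ cone N → ∃ u ∈ A, ∃ c : ℂ, c ≠ 0 ∧ v = c • φ u

theorem IsParamAt.inter {φ : E → V} {N U : Set P2} {u : E} (h : IsParamAt φ N u) (hU : IsOpen U)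
    (hu : φ u ∈ cone U) : IsParamAt φ (N ∩ U) u where
  diff := h.diff
  imm := h.imm
  mem := by
    filter_upwards [h.mem, h.diff.continuousAt.eventually ((isOpen_cone hU).mem_nhds hu)]
      with u' h1 h2
    exact mem_cone_inter.2 ⟨h1, h2⟩
  inv := by
    obtain ⟨l, g, h1, h2, h3, h4⟩ := h.inv
    refine ⟨l, g, h1, h2, h3, ?_⟩
    filter_upwards [h4] with v hv hvN
    exact hv (mem_cone_inter.1 hvN).1

theorem LocalParam.eventually_isParamAt [FiniteDimensional ℝ E] {φ : E → V} {N : Set P2}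
    (h : LocalParam φ N) : ∀ᶠ u in 𝓝 0, IsParamAt φ N u := by
  obtain ⟨l, g, hg⟩ := exists_homogeneous_leftInverse (ne_zero_of_mem_cone h.mem.self_of_nhds)
    h.contDiff h.imm
  have hdiff : ∀ᶠ u in 𝓝 (0 : E), DifferentiableAt ℝ φ u := by
    filter_upwards [h.contDiff.eventually (by decide)] with u hu
    exact hu.differentiableAt one_ne_zero
  have hsurj := h.contDiff.continuousAt.eventually (h.surj _ hg).eventually_nhds
  filter_upwards [hg.eventually_nhds, hdiff, h.mem.eventually_nhds, hsurj] with u h1 h2 h3 h4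
  obtain ⟨hl, h1u⟩ := h1.self_of_nhds
  have hgu := h1u 1 one_ne_zero
  rw [one_smul] at hgu
  refine ⟨h2, fun w c hw => ?_, h3, l, g, hl, hgu.1, hgu.2, ?_⟩
  -- `g ∘ φ` is the identity near `u`, while `g` is constant along the complex multiples of `φ u`.
  -- Hence `dg` kills `c • φ u`, and `dφ w = c • φ u` gives `w = dg (dφ w) = 0`.
  · have e1 : HasFDerivAt (fun u' => g (φ u')) ((fderiv ℝ g (φ u)).comp (fderiv ℝ φ u)) u :=
      hgu.2.hasFDerivAt.comp u h2.hasFDerivAt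
    have e2 : HasFDerivAt (fun u' => g (φ u')) (ContinuousLinearMap.id ℝ E) u := by
      refine (hasFDerivAt_id u).congr_of_eventuallyEq ?_
      filter_upwards [h1] with u' hu'
      simpa using (hu'.2 1 one_ne_zero).1
    have e3 := congrArg (fun A : E →L[ℝ] E => A w) (e1.unique e2)
    have e4 : HasDerivAt (fun t : ℝ => (1 + (t : ℂ) * c) • φ u) (c • φ u) 0 := by
      have : HasDerivAt (fun t : ℝ => (1 + (t : ℂ) * c)) c 0 := by
        have := ((Complex.ofRealCLM.hasDerivAt (x := (0 : ℝ))).mul_const c).const_add 1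
        simpa using this
      exact this.smul_const (φ u)
    have e5 : HasDerivAt (fun t : ℝ => g ((1 + (t : ℂ) * c) • φ u))
        (fderiv ℝ g (φ u) (c • φ u)) 0 := by
      have : HasFDerivAt g (fderiv ℝ g (φ u)) ((1 + ((0 : ℝ) : ℂ) * c) • φ u) := by
        simpa using hgu.2.hasFDerivAt
      exact this.comp_hasDerivAt 0 e4
    have e6 : HasDerivAt (fun t : ℝ => g ((1 + (t : ℂ) * c) • φ u)) 0 0 := by
      refine (hasDerivAt_const (0 : ℝ) u).congr_of_eventuallyEq ?_
      have : ∀ᶠ t : ℝ in 𝓝 0, (1 + (t : ℂ) * c) ≠ 0 := by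
        have hc : ContinuousAt (fun t : ℝ => (1 + (t : ℂ) * c)) 0 := by fun_prop
        exact hc.eventually_ne (by simp)
      filter_upwards [this] with t ht
      exact (h1u _ ht).1
    simp only [ContinuousLinearMap.comp_apply, ContinuousLinearMap.id_apply] at e3
    rw [← e3, hw, e5.unique e6]
  · filter_upwards [h4] with v hv hvN
    obtain ⟨u', ⟨hl', hu'⟩, c, hc, rfl⟩ := hv hvN
    rw [(hu' c hc).1, map_smul, smul_smul, smul_eq_mul, mul_comm]

/-- A curve `γ` in the cone satisfies `l(φ(g γ)) γ = l(γ) φ(g γ)` after rescaling; differentiating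
at `0` and solving for the velocity gives one direction. For the other, the curves `(c + t a) φ(u)`
and `c φ(u + t k)` realize the two summands. -/
theorem IsParamAt.mem_tangentLift_iff {φ : E → V} {N : Set P2} {u : E} (h : IsParamAt φ N u)
    {x : P2} {c : ℂ} (hc : c ≠ 0) (hx : x.rep = c • φ u) (t : V) :
    t ∈ tangentLift N x ↔ ∃ (a : ℂ) (k : E), t = a • φ u + c • fderiv ℝ φ u k := by
  constructor
  · intro ht
    let T : (ℂ × E) →ₗ[ℝ] V :=
      (LinearMap.toSpanSingleton ℂ V (φ u)).restrictScalars ℝ ∘ₗ LinearMap.fst ℝ ℂ E +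
        c • ((fderiv ℝ φ u : E →ₗ[ℝ] V) ∘ₗ LinearMap.snd ℝ ℂ E)
    have hT : ∀ a k, T (a, k) = a • φ u + c • fderiv ℝ φ u k := by
      intro a k
      simp [T]
    suffices h' : tangentLift N x ≤ LinearMap.range T by
      obtain ⟨⟨a, k⟩, hak⟩ := h' ht
      exact ⟨a, k, by rw [← hak, hT]⟩
    refine Submodule.span_le.2 ?_
    rintro w ⟨γ, h0, hd, hmem⟩
    obtain ⟨l, g, hl, hgu, hgd, hinv⟩ := h.inv
    rw [hx] at h0
    have h0' : c⁻¹ • γ 0 = φ u := by rw [h0, smul_smul, inv_mul_cancel₀ hc, one_smul]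
    have hd' : HasDerivAt (fun s => c⁻¹ • γ s) (c⁻¹ • w) 0 := hd.const_smul c⁻¹
    have hgγ : HasDerivAt (fun s => g (c⁻¹ • γ s)) (fderiv ℝ g (φ u) (c⁻¹ • w)) 0 := by
      refine HasFDerivAt.comp_hasDerivAt (l := g) (0 : ℝ) ?_ hd'
      rw [h0']
      exact hgd.hasFDerivAt
    set k := fderiv ℝ g (φ u) (c⁻¹ • w) with hk
    have hφγ : HasDerivAt (fun s => φ (g (c⁻¹ • γ s))) (fderiv ℝ φ u k) 0 := by
      refine HasFDerivAt.comp_hasDerivAt (l := φ) (0 : ℝ) ?_ hgγ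
      rw [h0', hgu]
      exact h.diff.hasFDerivAt
    have hlφ : HasDerivAt (fun s => l (φ (g (c⁻¹ • γ s)))) (l (fderiv ℝ φ u k)) 0 :=
      (l.restrictScalars ℝ).hasFDerivAt.comp_hasDerivAt 0 hφγ
    have hlγ : HasDerivAt (fun s => l (c⁻¹ • γ s)) (l (c⁻¹ • w)) 0 :=
      (l.restrictScalars ℝ).hasFDerivAt.comp_hasDerivAt 0 hd'
    have e1 := hlφ.smul hd'
    have e2 := hlγ.smul hφγ
    have hcont : Tendsto (fun s => c⁻¹ • γ s) (𝓝 0) (𝓝 (φ u)) := by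
      rw [← h0']
      exact hd'.continuousAt
    have e3 := e1.congr_of_eventuallyEq (f₁ := fun s => l (c⁻¹ • γ s) • φ (g (c⁻¹ • γ s))) (by
      filter_upwards [hmem, hcont.eventually hinv] with s hs1 hs2
      exact (hs2 ((smul_mem_cone_iff (inv_ne_zero hc)).2 hs1)).symm)
    have e4 := e2.unique e3
    rw [h0', hgu] at e4
    have e5 : l (φ u) • w =
        (c * (l (c⁻¹ • w) - l (fderiv ℝ φ u k))) • φ u + (c * l (φ u)) • fderiv ℝ φ u k := by
      have e6 : w = c • c⁻¹ • w := by rw [smul_smul, mul_inv_cancel₀ hc, one_smul]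
      have e7 : l (φ u) • c⁻¹ • w = l (φ u) • fderiv ℝ φ u k + l (c⁻¹ • w) • φ u
          - l (fderiv ℝ φ u k) • φ u := by
        rw [e4]; abel
      conv_lhs => rw [e6, smul_comm, e7]
      module
    refine ⟨((l (φ u))⁻¹ * (c * (l (c⁻¹ • w) - l (fderiv ℝ φ u k))), k), ?_⟩
    rw [hT]
    have e8 : w = (l (φ u))⁻¹ • l (φ u) • w := by rw [smul_smul, inv_mul_cancel₀ hl, one_smul]
    refine Eq.trans ?_ e8.symm
    rw [e5, smul_add, smul_smul, smul_smul]
    congr 2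
    rw [mul_left_comm, inv_mul_cancel₀ hl, mul_one]
  · rintro ⟨a, k, rfl⟩
    refine add_mem (Submodule.subset_span ?_) (Submodule.subset_span ?_)
    · refine ⟨fun t => (c + (t : ℂ) * a) • φ u, by simp [hx], ?_, ?_⟩
      · have : HasDerivAt (fun t : ℝ => (c + (t : ℂ) * a)) a 0 := by
          have := ((Complex.ofRealCLM.hasDerivAt (x := (0 : ℝ))).mul_const a).const_add c
          simpa using this
        exact this.smul_const (φ u)
      · have hcc : ContinuousAt (fun t : ℝ => (c + (t : ℂ) * a)) 0 := by fun_prop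
        filter_upwards [hcc.eventually_ne (y := 0) (by simpa using hc)] with t ht
        exact (smul_mem_cone_iff ht).2 h.mem.self_of_nhds
    · have hline : HasDerivAt (fun t : ℝ => u + t • k) k 0 := by
        simpa using ((hasDerivAt_id (0 : ℝ)).smul_const k).const_add u
      have hcomp : HasDerivAt (fun t : ℝ => φ (u + t • k)) (fderiv ℝ φ u k) 0 := by
        refine HasFDerivAt.comp_hasDerivAt (l := φ) (0 : ℝ) ?_ hline
        simpa using h.diff.hasFDerivAt
      refine ⟨fun t => c • φ (u + t • k), by simp [hx], hcomp.const_smul c, ?_⟩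
      have : Tendsto (fun t : ℝ => u + t • k) (𝓝 0) (𝓝 u) := by
        simpa using hline.continuousAt.tendsto
      filter_upwards [this.eventually h.mem] with t ht
      exact (smul_mem_cone_iff hc).2 ht

end

/-! ### Critical lines as conormals -/

theorem exists_re_mul_eq (f : ℂ →ₗ[ℝ] ℝ) : ∃ θ : ℂ, ∀ c, f c = (θ * c).re := by
  refine ⟨⟨f 1, -f Complex.I⟩, fun c => ?_⟩
  have h : c = c.re • (1 : ℂ) + c.im • Complex.I := by
    simp
  conv_lhs => rw [h, map_add, map_smul, map_smul]
  simp only [smul_eq_mul, Complex.mul_re]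
  ring

theorem exists_dotProduct_eq {b : V} (hb : b ≠ 0) : ∃ e : V, ∀ c : ℂ, b ⬝ᵥ (c • e) = c := by
  obtain ⟨i, hi⟩ := Function.ne_iff.1 hb
  refine ⟨Pi.single i (b i)⁻¹, fun c => ?_⟩
  rw [dotProduct_smul, dotProduct_single, mul_inv_cancel₀ hi, smul_eq_mul, mul_one]

/-- A proper real subspace lies in the kernel of a nonzero real functional. One that vanishes on the
plane of `d` factors through `v ↦ b ⬝ᵥ v`, and the real functionals on `ℂ` are `c ↦ Re (θ c)`. -/
theorem lineSpace_sup_ne_top_iff {b : V} {d : P2} (hbd : b ∈ cone {d}) (T : Submodule ℝ V) :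
    (lineSpace d).restrictScalars ℝ ⊔ T ≠ ⊤ ↔
      ∃ θ : ℂ, θ ≠ 0 ∧ ∀ t ∈ T, (θ * (b ⬝ᵥ t)).re = 0 := by
  obtain ⟨e, he⟩ := exists_dotProduct_eq (ne_zero_of_mem_cone hbd)
  constructor
  · intro h
    obtain ⟨f, hf0, hf⟩ := Submodule.exists_le_ker_of_lt_top _ (lt_top_iff_ne_top.2 h)
    obtain ⟨θ, hθ⟩ := exists_re_mul_eq
      (f ∘ₗ (LinearMap.toSpanSingleton ℂ V e).restrictScalars ℝ)
    have hfv : ∀ v, f v = (θ * (b ⬝ᵥ v)).re := by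
      intro v
      rw [← hθ]
      have h1 : v - (b ⬝ᵥ v) • e ∈ (lineSpace d).restrictScalars ℝ := by
        rw [Submodule.restrictScalars_mem, mem_lineSpace_iff hbd, dotProduct_sub, he, sub_self]
      have h2 : f (v - (b ⬝ᵥ v) • e) = 0 := hf (Submodule.mem_sup_left h1)
      rw [map_sub, sub_eq_zero] at h2
      exact h2
    refine ⟨θ, ?_, fun t ht => ?_⟩
    · rintro rfl
      exact hf0 (LinearMap.ext fun v => by simp [hfv])
    · rw [← hfv]
      exact hf (Submodule.mem_sup_right ht)
  · rintro ⟨θ, hθ, h⟩ htop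
    have hmem : θ⁻¹ • e ∈ (lineSpace d).restrictScalars ℝ ⊔ T := htop ▸ Submodule.mem_top
    obtain ⟨y, hy, t, ht, hyt⟩ := Submodule.mem_sup.1 hmem
    rw [Submodule.restrictScalars_mem, mem_lineSpace_iff hbd] at hy
    have h1 : b ⬝ᵥ t = θ⁻¹ := by rw [← he θ⁻¹, ← hyt, dotProduct_add, hy, zero_add]
    have h2 := h t ht
    rw [h1, mul_inv_cancel₀ hθ] at h2
    simp at h2

section

variable {E : Type*} [NormedAddCommGroup E] [NormedSpace ℝ E]

theorem IsParamAt.isCritical_iff {φ : E → V} {N : Set P2} {u : E} (h : IsParamAt φ N u)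
    {x d : P2} {b : V} (hx : φ u ∈ cone {x}) (hb : b ∈ cone {d}) :
    IsCritical N x d ↔ IsConormal φ u b := by
  obtain ⟨c, hc, hxc⟩ := exists_smul_of_mem_cone_singleton (rep_mem_cone_iff.2 rfl) hx
  have hxN : x ∈ N := (mem_iff_of_mem_cone_singleton hx).1 h.mem.self_of_nhds
  have h1 : x.rep ∈ lineSpace d ↔ b ⬝ᵥ φ u = 0 := by
    rw [mem_lineSpace_iff hb, hxc, dotProduct_smul, smul_eq_mul, mul_eq_zero_iff_left hc]
  rw [IsCritical, h1, lineSpace_sup_ne_top_iff hb]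
  refine ⟨fun ⟨_, h2, θ, hθ, h3⟩ => ⟨h2, θ * c, mul_ne_zero hθ hc, fun w => ?_⟩,
    fun ⟨h2, θ, hθ, h3⟩ => ⟨hxN, h2, θ * c⁻¹, mul_ne_zero hθ (inv_ne_zero hc), fun t ht => ?_⟩⟩
  · have := h3 (c • fderiv ℝ φ u w) ((h.mem_tangentLift_iff hc hxc _).2 ⟨0, w, by simp⟩)
    rwa [dotProduct_smul, smul_eq_mul, ← mul_assoc] at this
  · obtain ⟨a, k, rfl⟩ := (h.mem_tangentLift_iff hc hxc _).1 ht
    rw [dotProduct_add, dotProduct_smul, dotProduct_smul, h2, smul_zero, zero_add, smul_eq_mul,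
      ← mul_assoc, mul_assoc θ, inv_mul_cancel₀ hc, mul_one]
    exact h3 k

theorem IsParamAt.mem_cone_dual {φ : E → V} {N : Set P2} {u : E} (h : IsParamAt φ N u)
    {b : V} (hb : b ≠ 0) (hc : IsConormal φ u b) : b ∈ cone (dual N) :=
  ⟨hb, Projectivization.mk ℂ (φ u) (ne_zero_of_mem_cone h.mem.self_of_nhds),
    (h.isCritical_iff ⟨_, rfl⟩ ⟨hb, rfl⟩).2 hc⟩

/-- This makes dual germs well defined: shrinking `U₀` confines the points of tangency to parameters
in `A`, whatever the critical line. -/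
theorem LocalParam.exists_conormal_of_mem_dual [FiniteDimensional ℝ E] {φ : E → V} {N : Set P2}
    (h : LocalParam φ N) {A : Set E} (hA : A ∈ 𝓝 0) :
    ∃ U₀ : Set P2, IsOpen U₀ ∧ φ 0 ∈ cone U₀ ∧ ∀ U ⊆ U₀, IsOpen U → ∀ b ∈ cone (dual (N ∩ U)),
      ∃ u ∈ A, φ u ∈ cone U ∧ IsConormal φ u b := by
  obtain ⟨O, hOp, hO, h0⟩ := eventually_nhds_iff.1
    (h.surj _ (inter_mem hA h.eventually_isParamAt))
  refine ⟨proj O, isOpen_proj hO,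
    mem_cone_proj (ne_zero_of_mem_cone h.mem.self_of_nhds) h0, ?_⟩
  rintro U hU hUo b ⟨hb, x, hx⟩
  have hxNU : x.rep ∈ cone (N ∩ U) := rep_mem_cone_iff.2 hx.1
  obtain ⟨hxN, hxU⟩ := mem_cone_inter.1 hxNU
  obtain ⟨c, hc, hcO⟩ := exists_smul_mem_of_mem_cone_proj (cone_mono hU hxU)
  obtain ⟨u, ⟨huA, hu⟩, c', hc', hcu⟩ := hOp _ hcO ((smul_mem_cone_iff hc).2 hxN)
  have hrep : φ u = (c'⁻¹ * c) • x.rep := by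
    rw [mul_smul, hcu, smul_smul, inv_mul_cancel₀ hc', one_smul]
  have hcc := mul_ne_zero (inv_ne_zero hc') hc
  have huU : φ u ∈ cone U := by rwa [hrep, smul_mem_cone_iff hcc]
  have hux : φ u ∈ cone {x} := by
    rw [hrep, smul_mem_cone_iff hcc]
    exact rep_mem_cone_iff.2 rfl
  exact ⟨u, huA, huU, ((IsParamAt.inter hu hUo huU).isCritical_iff hux ⟨hb, rfl⟩).1 hx⟩

/-- The homogeneous left inverse is continuous at `φ 0`, so image points close to `[φ 0]` have
parameters close to `0`: the small image is embedded. -/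
theorem exists_localParam_image [FiniteDimensional ℝ E] {φ : E → V} (h0 : φ 0 ≠ 0)
    (hφ : ContDiffAt ℝ 1 φ 0)
    (himm : ∀ (w : E) (c : ℂ), fderiv ℝ φ 0 w = c • φ 0 → w = 0) {A : Set E} (hA : A ∈ 𝓝 0) :
    ∃ B ∈ 𝓝 (0 : E), B ⊆ A ∧ LocalParam φ {x | ∃ u ∈ B, φ u ∈ cone {x}} := by
  obtain ⟨l, g, hg⟩ := exists_homogeneous_leftInverse h0 hφ himm
  refine ⟨_, inter_mem hA hg, Set.inter_subset_left, hφ, himm, ?_, fun A' hA' => ?_⟩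
  · filter_upwards [inter_mem hA hg, hφ.continuousAt.eventually_ne h0] with u hu hu0
    exact ⟨hu0, u, hu, hu0, rfl⟩
  · obtain ⟨-, h2⟩ := hg.self_of_nhds
    obtain ⟨h3, h4⟩ := h2 1 one_ne_zero
    rw [one_smul] at h3 h4
    have h5 := h4.continuousAt.eventually (p := fun u => u ∈ A') (by rw [h3]; exact hA')
    filter_upwards [h5] with v hv
    rintro ⟨hv0, u, hu, hux⟩
    obtain ⟨c, hc, rfl⟩ := exists_smul_of_mem_cone_singleton ⟨hv0, rfl⟩ hux
    refine ⟨u, ?_, c, hc, rfl⟩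
    rwa [(hu.2.2 c hc).1] at hv

theorem IsSubmanifoldAt.exists_localParam {k m : ℕ} {N : Set P2} {z : P2}
    (h : IsSubmanifoldAt k m N z) (hk : 1 ≤ k) :
    ∃ φ : EuclideanSpace ℝ (Fin m) → V,
      ContDiffAt ℝ k φ 0 ∧ φ 0 ∈ cone {z} ∧ LocalParam φ N := by
  obtain ⟨φ, hφ, hc, himm, hz, hmap⟩ := h
  have hz' : φ 0 ∈ cone {z} := ⟨hφ 0, hz⟩
  refine ⟨φ, hc, hz', hc.of_le (by exact_mod_cast hk), fun w c hw => himm w ?_, ?_, ?_⟩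
  · rw [hw]
    exact Submodule.smul_mem _ _ (Submodule.mem_span_singleton_self _)
  · have h1 : ∀ᶠ x in 𝓝[N] z, x ∈ N := self_mem_nhdsWithin
    rw [← hmap, eventually_map] at h1
    filter_upwards [h1] with u hu
    exact ⟨hφ u, hu⟩
  · intro A hA
    have h1 := image_mem_map (m := fun u => Projectivization.mk ℂ (φ u) (hφ u)) hA
    rw [hmap, mem_nhdsWithin_iff_eventually, eventually_nhds_iff_cone hz'] at h1
    filter_upwards [h1]
    rintro v ⟨_, hv⟩ hvN
    obtain ⟨u, hu, hux⟩ := hv hvN.2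
    obtain ⟨c, hc, hvc⟩ := exists_smul_of_mem_cone_singleton (v := v) (w := φ u)
      ⟨hvN.1, rfl⟩ ⟨hφ u, hux⟩
    exact ⟨u, hu, c, hc, hvc⟩

theorem LocalParam.comp_equiv {F : Type*} [NormedAddCommGroup F] [NormedSpace ℝ F] {φ : E → V}
    {N : Set P2} (h : LocalParam φ N) (e : F ≃L[ℝ] E) : LocalParam (fun u => φ (e u)) N where
  contDiff := by
    refine ContDiffAt.comp (g := φ) 0 ?_ e.contDiff.contDiffAt
    rw [map_zero]
    exact h.contDiff
  imm := by
    intro w c hw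
    have h1 : HasFDerivAt φ (fderiv ℝ φ 0) (e 0) := by
      rw [map_zero]
      exact (h.contDiff.differentiableAt one_ne_zero).hasFDerivAt
    have h2 := h1.comp (0 : F) e.hasFDerivAt
    have h3 : fderiv ℝ (fun u => φ (e u)) 0 = (fderiv ℝ φ 0).comp (e : F →L[ℝ] E) := h2.fderiv
    rw [h3, map_zero] at hw
    simpa using h.imm (e w) c hw
  mem := by
    refine e.continuous.continuousAt.eventually (p := fun u => φ u ∈ cone N) ?_
    rw [map_zero]
    exact h.mem
  surj := by
    intro A hA
    have h1 : e.symm ⁻¹' A ∈ 𝓝 (0 : E) :=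
      e.symm.continuous.continuousAt.preimage_mem_nhds (by rwa [map_zero])
    rw [map_zero]
    filter_upwards [h.surj _ h1] with v hv hvN
    obtain ⟨u, hu, c, hc, hvc⟩ := hv hvN
    exact ⟨e.symm u, hu, c, hc, by simpa using hvc⟩

theorem LocalParam.congr {φ ψ : E → V} {N : Set P2} (h : LocalParam φ N) (he : ψ =ᶠ[𝓝 0] φ) :
    LocalParam ψ N where
  contDiff := h.contDiff.congr_of_eventuallyEq he
  imm := by
    rw [he.fderiv_eq, he.eq_of_nhds]
    exact h.imm
  mem := by
    filter_upwards [he, h.mem] with u hu hm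
    rwa [hu]
  surj := by
    intro A hA
    rw [he.eq_of_nhds]
    filter_upwards [h.surj _ (inter_mem hA he)] with v hv hvN
    obtain ⟨u, hu, c, hc, hvc⟩ := hv hvN
    exact ⟨u, hu.1, c, hc, by rw [hvc, show ψ u = φ u from hu.2]⟩

theorem LocalParam.isSubmanifoldAt [FiniteDimensional ℝ E] {φ : E → V} {N : Set P2} {z : P2}
    {m : ℕ} (hm : Module.finrank ℝ E = m) (h : LocalParam φ N) (hz : φ 0 ∈ cone {z}) :
    IsSubmanifoldAt 1 m N z := by
  let e : EuclideanSpace ℝ (Fin m) ≃L[ℝ] E :=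
    ContinuousLinearEquiv.ofFinrankEq (by rw [finrank_euclideanSpace_fin, hm])
  classical
  -- `IsSubmanifoldAt` wants a map that vanishes nowhere; the default value `φ 0` is only used away
  -- from `0`.
  let ψ : EuclideanSpace ℝ (Fin m) → V := fun u => if φ (e u) = 0 then φ 0 else φ (e u)
  have hψ0 : ∀ u, ψ u ≠ 0 := by
    intro u
    simp only [ψ]
    split_ifs with hu
    · exact ne_zero_of_mem_cone hz
    · exact hu
  have h1 := h.comp_equiv e
  have hψe : ψ =ᶠ[𝓝 0] fun u => φ (e u) := by
    filter_upwards [h1.mem] with u hu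
    exact if_neg (ne_zero_of_mem_cone hu)
  have h2 := h1.congr hψe
  have hz' : ψ 0 ∈ cone {z} := by
    rw [hψe.eq_of_nhds, map_zero]
    exact hz
  refine ⟨ψ, hψ0, h2.contDiff, fun w hw => ?_, hz'.2, le_antisymm ?_ ?_⟩
  · obtain ⟨c, hc⟩ := Submodule.mem_span_singleton.1 hw
    exact h2.imm w c hc.symm
  · refine le_inf (fun s hs => ?_) (le_principal_iff.2 ?_)
    · have h3 := h2.contDiff.continuousAt.eventually ((eventually_nhds_iff_cone hz').1 hs)
      refine mem_map.2 ?_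
      filter_upwards [h3] with u hu
      exact hu.2
    · refine mem_map.2 ?_
      filter_upwards [h2.mem] with u hu
      exact hu.2
  · intro s hs
    rw [mem_nhdsWithin_iff_eventually, eventually_nhds_iff_cone hz']
    filter_upwards [h2.surj _ hs, isOpen_compl_singleton.mem_nhds (hψ0 0)] with v hv hv0
    refine ⟨hv0, fun hvN => ?_⟩
    obtain ⟨u, hu, c, hc, hvc⟩ := hv ⟨hv0, hvN⟩
    have h4 : Projectivization.mk ℂ v hv0 = Projectivization.mk ℂ (ψ u) (hψ0 u) :=
      (Projectivization.mk_eq_mk_iff' ..).2 ⟨c, hvc.symm⟩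
    rw [h4]
    exact hu

end

/-! ### Cross products and determinants in `ℂ³` -/

theorem exists_smul_of_cross_eq_zero {a b : V} (ha : a ≠ 0) (h : crossProduct a b = 0) :
    ∃ c : ℂ, b = c • a := by
  have h0 := congrFun h 0
  have h1 := congrFun h 1
  have h2 := congrFun h 2
  simp only [cross_apply, Matrix.cons_val_zero, Matrix.cons_val_one, Matrix.cons_val,
    Pi.zero_apply] at h0 h1 h2
  obtain ⟨i, hi⟩ := Function.ne_iff.1 ha
  refine ⟨b i / a i, funext fun j => ?_⟩
  rw [Pi.zero_apply] at hi
  rw [Pi.smul_apply, smul_eq_mul, div_mul_eq_mul_div, eq_div_iff hi]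
  fin_cases i <;> fin_cases j <;> simp only [Fin.zero_eta, Fin.mk_one, Fin.reduceFinMk] <;> grind

theorem exists_smul_cross_of_dotProduct_eq_zero {a x b : V} (hn : crossProduct a x ≠ 0)
    (ha : b ⬝ᵥ a = 0) (hx : b ⬝ᵥ x = 0) : ∃ c : ℂ, b = c • crossProduct a x := by
  refine exists_smul_of_cross_eq_zero hn ?_
  simp only [dotProduct, Fin.sum_univ_three] at ha hx
  ext i
  fin_cases i <;> simp [cross_apply] <;> grind

theorem cross_ne_zero_of_forall {a x : V} (ha : a ≠ 0) (hx : ∀ c : ℂ, x ≠ c • a) :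
    crossProduct a x ≠ 0 := fun h => by
  obtain ⟨c, hc⟩ := exists_smul_of_cross_eq_zero ha h
  exact hx c hc

theorem dotProduct_cross_combination (a x y : V) (α β σ : ℂ) :
    a ⬝ᵥ crossProduct (α • x + β • y) (x + σ • y) = (α * σ - β) * (a ⬝ᵥ crossProduct x y) := by
  simp [cross_apply, dotProduct, Fin.sum_univ_three]
  ring

theorem cross_dotProduct_combination (a x y : V) (α β σ : ℂ) :
    crossProduct a (x + σ • y) ⬝ᵥ (α • x + β • y) = (β - α * σ) * (a ⬝ᵥ crossProduct x y) := by
  simp [cross_apply, dotProduct, Fin.sum_univ_three]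
  ring

theorem exists_combination_of_dotProduct_cross_eq_zero {a x y : V} (ha : a ≠ 0)
    (hx : ∀ c : ℂ, x ≠ c • a) (h : a ⬝ᵥ crossProduct x y = 0) :
    ∃ c d : ℂ, y = c • a + d • x := by
  rw [triple_product_eq_det] at h
  obtain ⟨v, hv, hv0⟩ := Matrix.exists_vecMul_eq_zero_iff.2 h
  have h1 : v 0 • a + v 1 • x + v 2 • y = 0 := by
    rw [← hv0]
    ext j
    simp [Matrix.vecMul, dotProduct, Fin.sum_univ_three]
  have h2 : v 2 ≠ 0 := by
    intro h2
    rw [h2, zero_smul, add_zero] at h1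
    have h3 : v 1 = 0 := by
      by_contra h3
      refine hx (-((v 1)⁻¹ * v 0)) ?_
      have h4 : v 1 • x = -(v 0 • a) := by
        rw [eq_neg_iff_add_eq_zero, add_comm, h1]
      rw [neg_smul, mul_smul, ← smul_neg, ← h4, smul_smul, inv_mul_cancel₀ h3, one_smul]
    rw [h3, zero_smul, add_zero] at h1
    have h5 : v 0 = 0 := (smul_eq_zero.1 h1).resolve_right ha
    refine hv (funext fun i => ?_)
    fin_cases i <;> simp [h2, h3, h5]
  refine ⟨-((v 2)⁻¹ * v 0), -((v 2)⁻¹ * v 1), ?_⟩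
  have h4 : v 2 • y = -(v 0 • a + v 1 • x) := by
    rw [eq_neg_iff_add_eq_zero, add_comm, h1]
  have h5 : y = (v 2)⁻¹ • v 2 • y := by rw [smul_smul, inv_mul_cancel₀ h2, one_smul]
  rw [h5, h4]
  module

/-- The cross product as a continuous real bilinear map. -/
noncomputable def crossR : V →L[ℝ] V →L[ℝ] V :=
  LinearMap.toContinuousBilinearMap ((crossProduct (R := ℂ)).restrictScalars₁₂ ℝ ℝ)

theorem crossR_apply (a b : V) : crossR a b = crossProduct a b := rfl

/-! ### The dual parametrization and its conormals -/

section

variable {E : Type*} [NormedAddCommGroup E] [NormedSpace ℝ E]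

theorem eq_of_forall_re_dotProduct_eq {a b : V}
    (h : ∀ v, (a ⬝ᵥ v).re = (b ⬝ᵥ v).re) : a = b := by
  ext i
  have h1 := h (Pi.single i 1)
  have h2 := h (Pi.single i Complex.I)
  simp only [dotProduct_single, mul_one, Complex.mul_I_re, neg_inj] at h1 h2
  exact Complex.ext h1 h2

/-- The conormal lines of a real hypersurface form a single complex line. -/
theorem IsConormal.exists_smul [FiniteDimensional ℝ E] (hE : Module.finrank ℝ E = 3) {ψ : E → V}
    {p : E} (h0 : ψ p ≠ 0) (himm : ∀ (w : E) (c : ℂ), fderiv ℝ ψ p w = c • ψ p → w = 0)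
    {b b' : V} (hb : IsConormal ψ p b) (hb' : IsConormal ψ p b') (hb'0 : b' ≠ 0) :
    ∃ c : ℂ, b = c • b' := by
  obtain ⟨h1, θ, hθ, h2⟩ := hb
  obtain ⟨h1', θ', hθ', h2'⟩ := hb'
  let T : (ℂ × E) →ₗ[ℝ] V :=
    (LinearMap.toSpanSingleton ℂ V (ψ p)).restrictScalars ℝ ∘ₗ LinearMap.fst ℝ ℂ E +
      (fderiv ℝ ψ p : E →ₗ[ℝ] V) ∘ₗ LinearMap.snd ℝ ℂ E
  have hT : ∀ a k, T (a, k) = a • ψ p + fderiv ℝ ψ p k := by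
    intro a k
    simp [T]
  have hinj : Function.Injective T := by
    refine (injective_iff_map_eq_zero T).2 ?_
    rintro ⟨a, k⟩ hak
    rw [hT] at hak
    have hk : k = 0 := by
      refine himm k (-a) ?_
      rw [neg_smul, eq_neg_iff_add_eq_zero, add_comm, hak]
    rw [hk, map_zero, add_zero] at hak
    rw [hk, (smul_eq_zero.1 hak).resolve_right h0]
    rfl
  let f : V → ℂ → V →ₗ[ℝ] ℝ := fun b θ =>
    { toFun := fun v => (θ * (b ⬝ᵥ v)).re
      map_add' := fun v w => by rw [dotProduct_add, mul_add, Complex.add_re]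
      map_smul' := fun r v => by
        rw [dotProduct_smul, mul_smul_comm, Complex.smul_re]
        rfl }
  have hf : ∀ b θ v, f b θ v = (θ * (b ⬝ᵥ v)).re := fun _ _ _ => rfl
  have hle : ∀ {b θ}, b ⬝ᵥ ψ p = 0 → (∀ w, (θ * (b ⬝ᵥ fderiv ℝ ψ p w)).re = 0) →
      LinearMap.range T ≤ LinearMap.ker (f b θ) := by
    rintro b θ h h' _ ⟨⟨a, k⟩, rfl⟩
    rw [LinearMap.mem_ker, hT, hf, dotProduct_add, dotProduct_smul, h, smul_zero, zero_add, h']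
  obtain ⟨e, he⟩ := exists_dotProduct_eq hb'0
  have he' : f b' θ' (θ'⁻¹ • e) = 1 := by
    rw [hf, he, mul_inv_cancel₀ hθ', Complex.one_re]
  have hf0 : f b' θ' ≠ 0 := by
    intro h
    rw [h] at he'
    simp at he'
  -- The lifted tangent space has real dimension `2 + 3 = 5` in `ℂ³ = ℝ⁶`, so it is the whole kernel
  -- of either nonzero functional that kills it, and the functionals are proportional.
  have hr : Module.finrank ℝ (LinearMap.range T) = 5 := by
    rw [LinearMap.finrank_range_of_inj hinj, Module.finrank_prod, hE, Complex.finrank_real_complex]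
  have hV : Module.finrank ℝ V = 6 := by
    rw [Module.finrank_pi_fintype]
    simp [Complex.finrank_real_complex]
  have hk := Module.Dual.finrank_ker_add_one_of_ne_zero hf0
  have heq : LinearMap.range T = LinearMap.ker (f b' θ') :=
    Submodule.eq_of_le_of_finrank_eq (hle h1' h2') (by omega)
  have hker : LinearMap.ker (f b' θ') ≤ LinearMap.ker (f b θ) := heq ▸ hle h1 h2
  set r : ℝ := f b θ (θ'⁻¹ • e)
  have hrel : ∀ v, f b θ v = r * f b' θ' v := by
    intro v
    have h3 : v - (f b' θ' v) • θ'⁻¹ • e ∈ LinearMap.ker (f b' θ') := by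
      rw [LinearMap.mem_ker, map_sub, map_smul, he', smul_eq_mul, mul_one, sub_self]
    have h4 := hker h3
    rw [LinearMap.mem_ker, map_sub, map_smul, sub_eq_zero] at h4
    rw [h4, smul_eq_mul, mul_comm]
  have h5 : θ • b = ((r : ℂ) * θ') • b' := by
    refine eq_of_forall_re_dotProduct_eq fun v => ?_
    have := hrel v
    rw [hf, hf] at this
    rw [smul_dotProduct, smul_dotProduct, smul_eq_mul, this, smul_eq_mul, mul_assoc,
      Complex.re_ofReal_mul]
  refine ⟨θ⁻¹ * (r * θ'), ?_⟩
  rw [mul_smul, ← h5, smul_smul, inv_mul_cancel₀ hθ, one_smul]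

/-- The line through `[φ u]` with direction `dφ_u (w₀ + σ w₁)`, in dual coordinates. -/
noncomputable def dualParam (φ : E → V) (w₀ w₁ : E) (p : E × ℝ) : V :=
  crossProduct (φ p.1) (fderiv ℝ φ p.1 (w₀ + p.2 • w₁))

/-- The determinant of `φ` and its partial derivatives in the directions `w₀`, `w₁`. -/
noncomputable def frameDet (φ : E → V) (w₀ w₁ u : E) : ℂ :=
  φ u ⬝ᵥ crossProduct (fderiv ℝ φ u w₀) (fderiv ℝ φ u w₁)

theorem contDiffAt_dualParam {φ : E → V} (hφ : ContDiffAt ℝ 2 φ 0) (w₀ w₁ : E) :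
    ContDiffAt ℝ 1 (dualParam φ w₀ w₁) 0 := by
  have h1 : ContDiffAt ℝ 1 (fun p : E × ℝ => φ p.1) 0 :=
    (hφ.of_le one_le_two).comp (g := φ) (0 : E × ℝ) contDiffAt_fst
  have h2 : ContDiffAt ℝ 1 (fun p : E × ℝ => fderiv ℝ φ p.1) 0 :=
    (hφ.fderiv_right (m := 1) (by norm_num)).comp (g := fderiv ℝ φ) (0 : E × ℝ) contDiffAt_fst
  have h3 : ContDiffAt ℝ 1 (fun p : E × ℝ => w₀ + p.2 • w₁) 0 :=
    contDiffAt_const.add (contDiffAt_snd.smul contDiffAt_const)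
  have h4 := h2.clm_apply h3
  exact (crossR.contDiff.contDiffAt.comp (0 : E × ℝ) h1).clm_apply h4

theorem fderiv_dualParam {φ : E → V} {u : E} {σ : ℝ} (h1 : DifferentiableAt ℝ φ u)
    (h2 : DifferentiableAt ℝ (fderiv ℝ φ) u) (w₀ w₁ h : E) (s : ℝ) :
    fderiv ℝ (dualParam φ w₀ w₁) (u, σ) (h, s) =
      crossProduct (φ u) (fderiv ℝ (fderiv ℝ φ) u h (w₀ + σ • w₁) + s • fderiv ℝ φ u w₁) +
        crossProduct (fderiv ℝ φ u h) (fderiv ℝ φ u (w₀ + σ • w₁)) := by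
  have e1 : HasFDerivAt (fun p : E × ℝ => φ p.1)
      ((fderiv ℝ φ u).comp (ContinuousLinearMap.fst ℝ E ℝ)) (u, σ) :=
    h1.hasFDerivAt.comp (u, σ) hasFDerivAt_fst
  have e2 : HasFDerivAt (fun p : E × ℝ => fderiv ℝ φ p.1)
      ((fderiv ℝ (fderiv ℝ φ) u).comp (ContinuousLinearMap.fst ℝ E ℝ)) (u, σ) :=
    h2.hasFDerivAt.comp (u, σ) hasFDerivAt_fst
  have e3 : HasFDerivAt (fun p : E × ℝ => w₀ + p.2 • w₁)
      ((ContinuousLinearMap.snd ℝ E ℝ).smulRight w₁) (u, σ) :=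
    (hasFDerivAt_snd.smul_const w₁).const_add w₀
  have e4 := (crossR.hasFDerivAt.comp (u, σ) e1).clm_apply (e2.clm_apply e3)
  have e5 : HasFDerivAt (dualParam φ w₀ w₁) _ (u, σ) := e4
  rw [e5.fderiv]
  simp [crossR_apply, add_comm]

theorem map_add_real_smul (A : E →L[ℝ] V) (x y : E) (σ : ℝ) :
    A (x + σ • y) = A x + (σ : ℂ) • A y := by
  rw [map_add, map_smul, Complex.coe_smul]

theorem map_real_combination (A : E →L[ℝ] V) (x y : E) (α β : ℝ) :
    A (α • x + β • y) = (α : ℂ) • A x + (β : ℂ) • A y := by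
  rw [map_add, map_smul, map_smul, Complex.coe_smul, Complex.coe_smul]

/-- The second derivatives of `φ` enter only through `φ u × ·`, which is orthogonal to `φ u`. What
survives is a real multiple of one complex number, which is the criticality condition for `φ u`. -/
theorem dotProduct_fderiv_dualParam {φ : E → V} {u : E} {σ : ℝ} (h1 : DifferentiableAt ℝ φ u)
    (h2 : DifferentiableAt ℝ (fderiv ℝ φ) u) (w₀ w₁ : E) (α β s : ℝ) :
    φ u ⬝ᵥ fderiv ℝ (dualParam φ w₀ w₁) (u, σ) (α • w₀ + β • w₁, s) =
      ((α * σ - β : ℝ) : ℂ) * frameDet φ w₀ w₁ u := by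
  rw [fderiv_dualParam h1 h2, dotProduct_add, dot_self_cross, zero_add, map_real_combination,
    map_add_real_smul, dotProduct_cross_combination, frameDet]
  push_cast
  ring

theorem exists_combination_of_linearIndependent (hE : Module.finrank ℝ E = 2) {w₀ w₁ : E}
    (hw : LinearIndependent ℝ ![w₀, w₁]) (h : E) : ∃ α β : ℝ, h = α • w₀ + β • w₁ := by
  have h1 := hw.span_eq_top_of_card_eq_finrank (by simp [hE])
  have h2 : h ∈ Submodule.span ℝ (Set.range ![w₀, w₁]) := h1 ▸ Submodule.mem_top
  rw [Matrix.range_cons, Matrix.range_cons, Matrix.range_empty, Set.union_empty,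
    Set.singleton_union, Submodule.mem_span_pair] at h2
  obtain ⟨α, β, h3⟩ := h2
  exact ⟨α, β, h3.symm⟩

theorem isConormal_dualParam {φ : E → V} {u : E} {σ : ℝ} (hE : Module.finrank ℝ E = 2)
    {w₀ w₁ : E} (hw : LinearIndependent ℝ ![w₀, w₁]) (h1 : DifferentiableAt ℝ φ u)
    (h2 : DifferentiableAt ℝ (fderiv ℝ φ) u) (hD : frameDet φ w₀ w₁ u ≠ 0) :
    IsConormal (dualParam φ w₀ w₁) (u, σ) (φ u) := by
  -- The factor `I / D` turns real multiples of `D` into imaginary numbers.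
  refine ⟨dot_self_cross _ _, Complex.I / frameDet φ w₀ w₁ u,
    div_ne_zero Complex.I_ne_zero hD, ?_⟩
  rintro ⟨h, s⟩
  obtain ⟨α, β, rfl⟩ := exists_combination_of_linearIndependent hE hw h
  rw [dotProduct_fderiv_dualParam h1 h2, mul_left_comm, div_mul_cancel₀ _ hD,
    Complex.re_ofReal_mul, Complex.I_re, mul_zero]

theorem isConormal_of_dualParam {φ : E → V} {p : E × ℝ} (hE : Module.finrank ℝ E = 2)
    {w₀ w₁ : E} (hw : LinearIndependent ℝ ![w₀, w₁]) (hD : frameDet φ w₀ w₁ p.1 ≠ 0) :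
    IsConormal φ p.1 (dualParam φ w₀ w₁ p) := by
  refine ⟨?_, Complex.I / frameDet φ w₀ w₁ p.1, div_ne_zero Complex.I_ne_zero hD, fun w => ?_⟩
  · rw [dotProduct_comm]
    exact dot_self_cross _ _
  · obtain ⟨α, β, rfl⟩ := exists_combination_of_linearIndependent hE hw w
    rw [dualParam, map_real_combination, map_add_real_smul, cross_dotProduct_combination]
    rw [← frameDet, mul_left_comm, div_mul_cancel₀ _ hD, ← Complex.ofReal_mul,
      ← Complex.ofReal_sub, Complex.re_ofReal_mul, Complex.I_re, mul_zero]

/-- If the frame determinant vanishes, then the tangent plane is complex. -/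
theorem IsParamAt.hasComplexTangent {φ : E → V} {N : Set P2} {u : E} (h : IsParamAt φ N u)
    (hE : Module.finrank ℝ E = 2) {x : P2} (hx : φ u ∈ cone {x}) {w₀ w₁ : E}
    (hw : LinearIndependent ℝ ![w₀, w₁]) (hD : frameDet φ w₀ w₁ u = 0) :
    HasComplexTangent N x := by
  obtain ⟨c, hc, hxc⟩ := exists_smul_of_mem_cone_singleton (rep_mem_cone_iff.2 rfl) hx
  have hw0 : w₀ ≠ 0 := hw.ne_zero 0
  obtain ⟨a, μ, hy⟩ := exists_combination_of_dotProduct_cross_eq_zero (ne_zero_of_mem_cone hx)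
    (fun d hd => hw0 (h.imm w₀ d hd)) hD
  -- A real `μ` would put `dφ (w₁ - μ w₀)` in `ℂ φ u`, against the immersion. So `1, μ` is a real
  -- basis of `ℂ`, and the real tangent plane fills a complex line.
  have hμ : μ.im ≠ 0 := by
    intro hμ
    have h1 : fderiv ℝ φ u (w₁ + (-μ.re) • w₀) = a • φ u := by
      rw [map_add_real_smul, hy]
      have h2 : ((μ.re : ℝ) : ℂ) = μ := Complex.ext rfl (by simp [hμ])
      rw [Complex.ofReal_neg, h2]
      module
    have h3 := h.imm _ _ h1
    have h4 := LinearIndependent.pair_iff.1 hw (-μ.re) 1 (by rw [← h3]; module)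
    exact one_ne_zero h4.2
  refine ⟨Submodule.span ℂ {φ u, fderiv ℝ φ u w₀}, Submodule.ext fun t => ?_⟩
  rw [Submodule.restrictScalars_mem, Submodule.mem_span_pair, h.mem_tangentLift_iff hc hxc]
  constructor
  · rintro ⟨p, q, rfl⟩
    set β := (q / c).im / μ.im with hβ
    set α := (q / c).re - β * μ.re with hα
    have h1 : (α : ℂ) + β * μ = q / c := by
      apply Complex.ext
      · simp [hα]
      · simp [hβ, hμ]
    refine ⟨p - c * β * a, α • w₀ + β • w₁, ?_⟩
    have h2 : q = c * (α + β * μ) := by rw [h1, mul_div_cancel₀ _ hc]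
    rw [map_real_combination, hy, h2]
    module
  · rintro ⟨p, k, rfl⟩
    obtain ⟨α, β, rfl⟩ := exists_combination_of_linearIndependent hE hw k
    refine ⟨p + c * β * a, c * (α + β * μ), ?_⟩
    rw [map_real_combination, hy]
    module

/-- The direction in the surface which is tangent to a critical line. -/
theorem IsConormal.exists_direction {φ : E → V} {u : E} {b : V} (h : IsConormal φ u b)
    [FiniteDimensional ℝ E] (hE : Module.finrank ℝ E = 2) :
    ∃ w ≠ 0, b ⬝ᵥ fderiv ℝ φ u w = 0 := by
  obtain ⟨-, θ, hθ, h2⟩ := h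
  -- The real part vanishes identically; the imaginary part is a single real linear form on a plane,
  -- so it has a nonzero kernel.
  let f : E →ₗ[ℝ] ℝ :=
    { toFun := fun w => (θ * (b ⬝ᵥ fderiv ℝ φ u w)).im
      map_add' := fun v w => by rw [map_add, dotProduct_add, mul_add, Complex.add_im]
      map_smul' := fun r v => by
        rw [map_smul, dotProduct_smul, mul_smul_comm, Complex.smul_im]
        rfl }
  have hker : LinearMap.ker f ≠ ⊥ := LinearMap.ker_ne_bot_of_finrank_lt (by simp [hE])
  obtain ⟨w, hw, hw0⟩ := Submodule.exists_mem_ne_zero_of_ne_bot hker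
  refine ⟨w, hw0, ?_⟩
  have h3 : θ * (b ⬝ᵥ fderiv ℝ φ u w) = 0 := Complex.ext (h2 w) hw
  exact (mul_eq_zero.1 h3).resolve_left hθ

/-- The curve `φ(t w₀ + (t² / 2) c w₁)` has velocity `dφ w₀` and second derivative `φ''(w₀, w₀) + c
dφ w₁` at `0`. -/
theorem isExceptional_of_second_derivative {φ : E → V} {S : Set P2} {z d : P2}
    (hφ : ContDiffAt ℝ 2 φ 0) (hS : LocalParam φ S) (hz : φ 0 ∈ cone {z}) (hcrit : IsCritical S z d)
    {b : V} (hb : b ∈ cone {d}) {w₀ w₁ : E} (hw0 : w₀ ≠ 0) (hb0 : b ⬝ᵥ fderiv ℝ φ 0 w₀ = 0) (c : ℝ)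
    (hc : b ⬝ᵥ (fderiv ℝ (fderiv ℝ φ) 0 w₀ w₀ + c • fderiv ℝ φ 0 w₁) = 0) :
    IsExceptional S z d := by
  let η : ℝ → E := fun t => t • w₀ + (t ^ 2 / 2 * c) • w₁
  have hη0 : η 0 = 0 := by simp [η]
  have hηd : ∀ t, HasDerivAt η (w₀ + (t * c) • w₁) t := by
    intro t
    have h1 : HasDerivAt (fun t : ℝ => t ^ 2 / 2 * c) (t * c) t := by
      have := ((hasDerivAt_pow 2 t).div_const 2).mul_const c
      have e : ((2 : ℕ) : ℝ) * t ^ (2 - 1) / 2 * c = t * c := by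
        norm_num
      rwa [e] at this
    have h2 := ((hasDerivAt_id t).smul_const w₀).add (h1.smul_const w₁)
    rwa [one_smul] at h2
  have hηc : ContDiffAt ℝ 2 η 0 := by fun_prop
  have hηt : Tendsto η (𝓝 0) (𝓝 0) := by
    have := (hηd 0).continuousAt.tendsto
    rwa [hη0] at this
  have hφη : ContDiffAt ℝ 2 φ (η 0) := by rwa [hη0]
  have hd : ∀ᶠ u in 𝓝 (0 : E), DifferentiableAt ℝ φ u :=
    (hφ.eventually (by decide)).mono fun u hu => hu.differentiableAt two_ne_zero
  have hγd : ∀ᶠ t in 𝓝 (0 : ℝ),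
      HasDerivAt (fun t => φ (η t)) (fderiv ℝ φ (η t) (w₀ + (t * c) • w₁)) t := by
    filter_upwards [hηt.eventually hd] with t ht
    exact ht.hasFDerivAt.comp_hasDerivAt t (hηd t)
  have hγ1 : deriv (fun t => φ (η t)) 0 = fderiv ℝ φ 0 w₀ := by
    rw [hγd.self_of_nhds.deriv, hη0]
    simp
  have hγ2 : iteratedDeriv 2 (fun t => φ (η t)) 0 =
      fderiv ℝ (fderiv ℝ φ) 0 w₀ w₀ + c • fderiv ℝ φ 0 w₁ := by
    rw [iteratedDeriv_succ, iteratedDeriv_one]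
    have h1 : deriv (fun t => φ (η t)) =ᶠ[𝓝 0] fun t => fderiv ℝ φ (η t) (w₀ + (t * c) • w₁) :=
      hγd.mono fun t ht => ht.deriv
    rw [h1.deriv_eq]
    have h2 : HasDerivAt (fun t => fderiv ℝ φ (η t))
        (fderiv ℝ (fderiv ℝ φ) 0 (w₀ + ((0 : ℝ) * c) • w₁)) 0 := by
      refine HasFDerivAt.comp_hasDerivAt (l := fderiv ℝ φ) (0 : ℝ) ?_ (hηd 0)
      rw [hη0]
      exact ((hφ.fderiv_right (m := 1) (by norm_num)).differentiableAt one_ne_zero).hasFDerivAt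
    have h3 : HasDerivAt (fun t : ℝ => w₀ + (t * c) • w₁) (c • w₁) 0 := by
      simpa using (((hasDerivAt_id (0 : ℝ)).mul_const c).smul_const w₁).const_add w₀
    rw [(h2.clm_apply h3).deriv, hη0]
    simp
  refine ⟨hcrit, fun t => φ (η t), hφη.comp 0 hηc, hηt.eventually hS.mem, ?_, ?_, ?_, ?_⟩
  · obtain ⟨hz0, rfl⟩ := hz
    simp only [hη0]
    rw [Projectivization.submodule_mk]
    exact Submodule.mem_span_singleton_self _
  · simp only [hγ1, hη0]
    intro h
    obtain ⟨a, ha⟩ := Submodule.mem_span_singleton.1 h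
    exact hw0 (hS.imm w₀ a ha.symm)
  · rw [hγ1, mem_lineSpace_iff hb, hb0]
  · rw [hγ2, mem_lineSpace_iff hb, hc]

theorem cross_dotProduct_swap (a x v : V) :
    crossProduct a x ⬝ᵥ v = -(x ⬝ᵥ crossProduct a v) := by
  simp [cross_apply, dotProduct, Fin.sum_univ_three]
  ring

theorem dualParam_zero (φ : E → V) (w₀ w₁ : E) :
    dualParam φ w₀ w₁ 0 = crossProduct (φ 0) (fderiv ℝ φ 0 w₀) := by
  simp [dualParam]

/-- At a non-exceptional critical line, the dual parametrization is an immersion. -/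
theorem dualParam_immersion {φ : E → V} {S : Set P2} {z d : P2} (hE : Module.finrank ℝ E = 2)
    (hφ : ContDiffAt ℝ 2 φ 0) (hS : LocalParam φ S) (hz : φ 0 ∈ cone {z}) (hcrit : IsCritical S z d)
    (hex : ¬ IsExceptional S z d) {w₀ w₁ : E} (hw : LinearIndependent ℝ ![w₀, w₁])
    (hd : dualParam φ w₀ w₁ 0 ∈ cone {d}) (hD : frameDet φ w₀ w₁ 0 ≠ 0) (k : E × ℝ) (c : ℂ)
    (hk : fderiv ℝ (dualParam φ w₀ w₁) 0 k = c • dualParam φ w₀ w₁ 0) : k = 0 := by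
  obtain ⟨h, s⟩ := k
  obtain ⟨α, β, rfl⟩ := exists_combination_of_linearIndependent hE hw h
  have h1 : DifferentiableAt ℝ φ 0 := hφ.differentiableAt two_ne_zero
  have h2 : DifferentiableAt ℝ (fderiv ℝ φ) 0 :=
    (hφ.fderiv_right (m := 1) (by norm_num)).differentiableAt one_ne_zero
  -- Pairing with `φ 0` kills `c • ψ(0)`; at `σ = 0` the other side is `-β D`.
  have hβ : β = 0 := by
    have h3 := congrArg (fun v => φ 0 ⬝ᵥ v) hk
    have h4 := dotProduct_fderiv_dualParam (σ := 0) h1 h2 w₀ w₁ α β s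
    rw [dualParam_zero] at h3
    simp only [dotProduct_smul, dot_self_cross, smul_zero] at h3
    rw [← Prod.zero_eq_mk, h3] at h4
    simpa [hD] using h4.symm
  subst hβ
  -- With `β = 0` the product of first derivatives drops out, leaving `φ 0 × x = c • ψ(0)` for the
  -- vector `x` displayed here. Then `ψ(0) · x = -(dφ w₀ · (φ 0 × x))`, and `dφ w₀` is orthogonal to
  -- `ψ(0)`.
  have h5 : dualParam φ w₀ w₁ 0 ⬝ᵥ
      (α • fderiv ℝ (fderiv ℝ φ) 0 w₀ w₀ + s • fderiv ℝ φ 0 w₁) = 0 := by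
    have h3 := fderiv_dualParam (σ := 0) h1 h2 w₀ w₁ (α • w₀ + (0 : ℝ) • w₁) s
    rw [← Prod.zero_eq_mk, hk, dualParam_zero] at h3
    rw [zero_smul, add_zero, add_zero, map_smul, map_smul, smul_apply,
      ← Complex.coe_smul α (fderiv ℝ φ 0 w₀), map_smul (crossProduct (R := ℂ)),
      LinearMap.smul_apply, cross_self, smul_zero, add_zero] at h3
    rw [dualParam_zero, cross_dotProduct_swap, ← h3, dotProduct_smul, dot_cross_self, smul_zero,
      neg_zero]
  have hw0 : w₀ ≠ 0 := hw.ne_zero 0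
  have hα : α = 0 := by
    by_contra hα
    refine hex (isExceptional_of_second_derivative hφ hS hz hcrit hd hw0
      ?_ (s / α) (w₁ := w₁) ?_)
    · rw [dualParam_zero, dotProduct_comm]
      exact dot_cross_self _ _
    · have h6 : fderiv ℝ (fderiv ℝ φ) 0 w₀ w₀ + (s / α) • fderiv ℝ φ 0 w₁ =
          α⁻¹ • (α • fderiv ℝ (fderiv ℝ φ) 0 w₀ w₀ + s • fderiv ℝ φ 0 w₁) := by
        rw [smul_add, smul_smul, smul_smul, inv_mul_cancel₀ hα, one_smul, div_eq_inv_mul]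
      rw [h6, dotProduct_smul, h5, smul_zero]
  subst hα
  have hs : s = 0 := by
    have h6 : dualParam φ w₀ w₁ 0 ⬝ᵥ fderiv ℝ φ 0 w₁ = frameDet φ w₀ w₁ 0 := by
      have := cross_dotProduct_combination (φ 0) (fderiv ℝ φ 0 w₀) (fderiv ℝ φ 0 w₁) 0 1 0
      simpa [dualParam_zero, frameDet] using this
    rw [zero_smul, zero_add, dotProduct_smul, h6] at h5
    exact (smul_eq_zero.1 h5).resolve_right hD
  simp [hs]

end

/-! ### Surface germs with a nondegenerate dual frame -/

/-- The data of a surface germ and of a nondegenerate dual parametrization. -/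
structure DualFrame {E : Type*} [NormedAddCommGroup E] [NormedSpace ℝ E] (φ : E → V) (w₀ w₁ : E)
    (S : Set P2) (z d : P2) : Prop where
  finrank_eq : Module.finrank ℝ E = 2
  contDiff : ContDiffAt ℝ 2 φ 0
  param : LocalParam φ S
  point : φ 0 ∈ cone {z}
  indep : LinearIndependent ℝ ![w₀, w₁]
  det_ne : frameDet φ w₀ w₁ 0 ≠ 0
  line : dualParam φ w₀ w₁ 0 ∈ cone {d}
  imm : ∀ (k : E × ℝ) (c : ℂ),
    fderiv ℝ (dualParam φ w₀ w₁) 0 k = c • dualParam φ w₀ w₁ 0 → k = 0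

theorem IsRegularPair.exists_dualFrame {S : Set P2} {z d : P2} (h : IsRegularPair S z d) :
    ∃ (φ : EuclideanSpace ℝ (Fin 2) → V) (w₀ w₁ : EuclideanSpace ℝ (Fin 2)),
      DualFrame φ w₀ w₁ S z d := by
  obtain ⟨φ, hφ, hz, hS⟩ := h.surface.exists_localParam one_le_two
  have hE : Module.finrank ℝ (EuclideanSpace ℝ (Fin 2)) = 2 := finrank_euclideanSpace_fin
  have hP := hS.eventually_isParamAt.self_of_nhds
  have hb : d.rep ∈ cone {d} := rep_mem_cone_iff.2 rfl
  have hcon := (hP.isCritical_iff hz hb).1 h.critical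
  -- Taking `w₀` tangent to `d` places `d` at the parameter `(0, 0)`; `w₁` is any complement.
  obtain ⟨w₀, hw0, hbw⟩ := hcon.exists_direction hE
  obtain ⟨w₁, hw⟩ := exists_linearIndependent_pair_of_one_lt_finrank
    (R := ℝ) (by rw [hE]; exact one_lt_two) hw0
  have hD : frameDet φ w₀ w₁ 0 ≠ 0 := fun hD => h.not_complex (hP.hasComplexTangent hE hz hw hD)
  have hn : crossProduct (φ 0) (fderiv ℝ φ 0 w₀) ≠ 0 :=
    cross_ne_zero_of_forall (ne_zero_of_mem_cone hz) fun c hc => hw0 (hP.imm w₀ c hc)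
  have hline : dualParam φ w₀ w₁ 0 ∈ cone {d} := by
    obtain ⟨c, hc⟩ := exists_smul_cross_of_dotProduct_eq_zero hn hcon.1 hbw
    have hc0 : c ≠ 0 := by
      rintro rfl
      exact ne_zero_of_mem_cone hb (by rw [hc, zero_smul])
    rw [hc, smul_mem_cone_iff hc0] at hb
    rwa [dualParam_zero]
  exact ⟨φ, w₀, w₁, hE, by exact_mod_cast hφ, hS, hz, hw, hD, hline,
    dualParam_immersion hE (by exact_mod_cast hφ) hS hz h.critical h.not_exceptional hw hline hD⟩

/-! ### The dual germ and the bidual germ -/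

section

variable {E : Type*} [NormedAddCommGroup E] [NormedSpace ℝ E] {φ : E → V} {w₀ w₁ : E}
  {S : Set P2} {z d : P2}

/-- The conditions on `[φ u]` under which the dual parametrization is well behaved at `(u, σ)`. -/
structure IsGood (φ : E → V) (w₀ w₁ : E) (S : Set P2) (u : E) : Prop where
  param : IsParamAt φ S u
  diff : DifferentiableAt ℝ (fderiv ℝ φ) u
  det_ne : frameDet φ w₀ w₁ u ≠ 0

theorem continuousAt_dotProduct {X : Type*} [TopologicalSpace X] {f g : X → V} {x : X}
    (hf : ContinuousAt f x) (hg : ContinuousAt g x) : ContinuousAt (fun y => f y ⬝ᵥ g y) x := by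
  have h : Continuous fun p : V × V => p.1 ⬝ᵥ p.2 := by fun_prop
  exact h.continuousAt.comp (hf.prodMk hg)

theorem DualFrame.continuousAt_fderiv (h : DualFrame φ w₀ w₁ S z d) (w : E) :
    ContinuousAt (fun u => fderiv ℝ φ u w) 0 :=
  ((h.contDiff.fderiv_right (m := 1) (by norm_num)).continuousAt).clm_apply continuousAt_const

theorem DualFrame.eventually_isGood [FiniteDimensional ℝ E] (h : DualFrame φ w₀ w₁ S z d) :
    ∀ᶠ u in 𝓝 (0 : E), IsGood φ w₀ w₁ S u := by
  have h1 : ContinuousAt (frameDet φ w₀ w₁) 0 := by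
    have h2 : ContinuousAt (fun u => crossR (fderiv ℝ φ u w₀)) 0 :=
      crossR.continuous.continuousAt.comp (h.continuousAt_fderiv w₀)
    exact continuousAt_dotProduct h.contDiff.continuousAt
      (h2.clm_apply (h.continuousAt_fderiv w₁))
  have h3 : ContDiffAt ℝ 1 (fderiv ℝ φ) 0 := h.contDiff.fderiv_right (m := 1) (by norm_num)
  filter_upwards [h.param.eventually_isParamAt, h1.eventually_ne h.det_ne,
    h3.eventually (by decide)] with u hu1 hu2 hu3
  exact ⟨hu1, hu3.differentiableAt one_ne_zero, hu2⟩

/-- Pointwise biduality: `φ p.1` is conormal to the dual hypersurface at `p`, and a hypersurface has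
only one conormal up to complex scaling. -/
theorem DualFrame.isConormal_iff [FiniteDimensional ℝ E] (h : DualFrame φ w₀ w₁ S z d)
    {H : Set P2} {p : E × ℝ} (hp : IsGood φ w₀ w₁ S p.1) (hH : IsParamAt (dualParam φ w₀ w₁) H p)
    {b : V} (hb : b ≠ 0) :
    IsConormal (dualParam φ w₀ w₁) p b ↔ ∃ c : ℂ, c ≠ 0 ∧ b = c • φ p.1 := by
  have h1 : IsConormal (dualParam φ w₀ w₁) p (φ p.1) :=
    isConormal_dualParam h.finrank_eq h.indep hp.param.diff hp.diff hp.det_ne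
  constructor
  · intro hc
    obtain ⟨c, hcb⟩ := hc.exists_smul (by rw [Module.finrank_prod, h.finrank_eq,
      Module.finrank_self]) (ne_zero_of_mem_cone hH.mem.self_of_nhds) hH.imm h1
      (ne_zero_of_mem_cone hp.param.mem.self_of_nhds)
    refine ⟨c, ?_, hcb⟩
    rintro rfl
    exact hb (by rw [hcb, zero_smul])
  · rintro ⟨c, hc, rfl⟩
    obtain ⟨h2, θ, hθ, h3⟩ := h1
    refine ⟨by rw [smul_dotProduct, h2, smul_zero], θ * c⁻¹, mul_ne_zero hθ (inv_ne_zero hc),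
      fun w => ?_⟩
    rw [smul_dotProduct, smul_eq_mul, mul_assoc, inv_mul_cancel_left₀ hc]
    exact h3 w

theorem DualFrame.isCritical_iff [FiniteDimensional ℝ E] (h : DualFrame φ w₀ w₁ S z d)
    {H : Set P2} (hH : LocalParam (dualParam φ w₀ w₁) H) (x : P2) :
    IsCritical H d x ↔ x = z := by
  have hx : x.rep ∈ cone {x} := rep_mem_cone_iff.2 rfl
  have hP := hH.eventually_isParamAt.self_of_nhds
  rw [hP.isCritical_iff h.line hx,
    h.isConormal_iff h.eventually_isGood.self_of_nhds hP x.rep_nonzero]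
  constructor
  · rintro ⟨c, hc, hxc⟩
    have h1 : x.rep ∈ cone {z} := by
      rw [hxc, smul_mem_cone_iff hc]
      exact h.point
    exact (rep_mem_cone_iff (N := {z})).1 h1
  · rintro rfl
    exact exists_smul_of_mem_cone_singleton hx h.point

theorem eventually_iff_of_cone {v : V} {x : P2} (hv : v ∈ cone {x}) {M N : Set P2}
    (h : ∀ᶠ w in 𝓝 v, w ∈ cone M ↔ w ∈ cone N) : ∀ᶠ y in 𝓝 x, (y ∈ M ↔ y ∈ N) := by
  rw [eventually_nhds_iff_cone hv]
  filter_upwards [h, isOpen_compl_singleton.mem_nhds (ne_zero_of_mem_cone hv)] with w hw hw0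
  rw [mem_cone_iff hw0, mem_cone_iff hw0] at hw
  exact ⟨hw0, hw⟩

theorem DualFrame.isDualGerm_dual [FiniteDimensional ℝ E] (h : DualFrame φ w₀ w₁ S z d)
    {H : Set P2} (hH : LocalParam (dualParam φ w₀ w₁) H) : IsDualGerm H d z S := by
  have hgood : ∀ᶠ p in 𝓝 (0 : E × ℝ),
      IsGood φ w₀ w₁ S p.1 ∧ IsParamAt (dualParam φ w₀ w₁) H p :=
    (continuousAt_fst.eventually h.eventually_isGood).and hH.eventually_isParamAt
  obtain ⟨U₀, hU₀, h0, hdual⟩ := hH.exists_conormal_of_mem_dual hgood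
  refine ⟨U₀, hU₀.mem_nhds ((mem_iff_of_mem_cone_singleton h.line).1 h0), fun U hU hUo hdU => ?_⟩
  refine eventually_iff_of_cone h.point ?_
  have hψU : ∀ᶠ p in 𝓝 (0 : E × ℝ), dualParam φ w₀ w₁ p ∈ cone U :=
    hH.contDiff.continuousAt.eventually ((isOpen_cone hUo).mem_nhds
      ((mem_iff_of_mem_cone_singleton h.line).2 hdU))
  -- Each point `[φ u]` is critical at `ψ(u, σ)` for all small `σ`; the choice `σ = 0` is enough to
  -- recover it.
  have hemb : Tendsto (fun u : E => (u, (0 : ℝ))) (𝓝 0) (𝓝 0) :=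
    (continuous_id.prodMk continuous_const).tendsto' 0 0 rfl
  filter_upwards [h.param.surj _ (hemb.eventually (hgood.and hψU))] with v hv
  constructor
  · intro hvd
    obtain ⟨p, ⟨hp1, hp2⟩, -, hcon⟩ := hdual U hU hUo v hvd
    obtain ⟨c, hc, rfl⟩ := (h.isConormal_iff hp1 hp2 (ne_zero_of_mem_cone hvd)).1 hcon
    exact (smul_mem_cone_iff hc).2 hp1.param.mem.self_of_nhds
  · intro hvS
    obtain ⟨u, ⟨⟨hu1, hu2⟩, hu3⟩, c, hc, rfl⟩ := hv hvS
    refine (hu2.inter hUo hu3).mem_cone_dual (ne_zero_of_mem_cone hvS) ?_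
    exact (h.isConormal_iff hu1 hu2 (ne_zero_of_mem_cone hvS)).2 ⟨c, hc, rfl⟩

/-- A critical line at `[φ u]` which is not tangent to the direction `w₁` is tangent to a unique
direction `w₀ + σ w₁`. -/
theorem IsConormal.exists_smul_dualParam {u : E} {b : V} (h : IsConormal φ u b) (hb : b ≠ 0)
    (hw : LinearIndependent ℝ ![w₀, w₁]) (hφ0 : φ u ≠ 0)
    (himm : ∀ (w : E) (c : ℂ), fderiv ℝ φ u w = c • φ u → w = 0)
    (h1 : b ⬝ᵥ fderiv ℝ φ u w₁ ≠ 0) :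
    ∃ c : ℂ, c ≠ 0 ∧ b = c • dualParam φ w₀ w₁
      (u, -((b ⬝ᵥ fderiv ℝ φ u w₀) / (b ⬝ᵥ fderiv ℝ φ u w₁)).re) := by
  obtain ⟨hbu, θ, hθ, hre⟩ := h
  set σ : ℝ := -((b ⬝ᵥ fderiv ℝ φ u w₀) / (b ⬝ᵥ fderiv ℝ φ u w₁)).re with hσ
  have hdir : b ⬝ᵥ fderiv ℝ φ u (w₀ + σ • w₁) = 0 := by
    -- After multiplication by `θ` both terms are imaginary, so their quotient is real.
    have hq : ((b ⬝ᵥ fderiv ℝ φ u w₀) / (b ⬝ᵥ fderiv ℝ φ u w₁)).im = 0 := by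
      rw [← mul_div_mul_left _ _ hθ, Complex.div_im, hre w₀, hre w₁]
      simp
    have hq' : ((σ : ℝ) : ℂ) = -((b ⬝ᵥ fderiv ℝ φ u w₀) / (b ⬝ᵥ fderiv ℝ φ u w₁)) := by
      apply Complex.ext
      · simp [hσ]
      · rw [Complex.ofReal_im, Complex.neg_im, hq, neg_zero]
    rw [map_add_real_smul, dotProduct_add, dotProduct_smul, hq', smul_eq_mul, neg_mul,
      div_mul_cancel₀ _ h1, add_neg_cancel]
  have hn : crossProduct (φ u) (fderiv ℝ φ u (w₀ + σ • w₁)) ≠ 0 := by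
    refine cross_ne_zero_of_forall hφ0 fun c hc => ?_
    have h2 := himm _ c hc
    have h3 := LinearIndependent.pair_iff.1 hw 1 σ (by rw [one_smul, h2])
    exact one_ne_zero h3.1
  obtain ⟨c, hc⟩ := exists_smul_cross_of_dotProduct_eq_zero hn hbu hdir
  refine ⟨c, ?_, hc⟩
  rintro rfl
  exact hb (by rw [hc, zero_smul])

theorem DualFrame.exists_isDualGerm [FiniteDimensional ℝ E] (h : DualFrame φ w₀ w₁ S z d) :
    ∃ H : Set P2, LocalParam (dualParam φ w₀ w₁) H ∧ IsDualGerm S z d H := by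
  obtain ⟨B, hB, -, hH⟩ := exists_localParam_image (ne_zero_of_mem_cone h.line)
    (contDiffAt_dualParam h.contDiff w₀ w₁) h.imm univ_mem
  refine ⟨_, hH, ?_⟩
  set ψ := dualParam φ w₀ w₁ with hψ
  have hbw₀ : ψ 0 ⬝ᵥ fderiv ℝ φ 0 w₀ = 0 := by
    rw [hψ, dualParam_zero, dotProduct_comm]
    exact dot_cross_self _ _
  have hbw₁ : ψ 0 ⬝ᵥ fderiv ℝ φ 0 w₁ ≠ 0 := by
    have := cross_dotProduct_combination (φ 0) (fderiv ℝ φ 0 w₀) (fderiv ℝ φ 0 w₁) 0 1 0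
    have h2 : ψ 0 ⬝ᵥ fderiv ℝ φ 0 w₁ = frameDet φ w₀ w₁ 0 := by
      simpa [hψ, dualParam_zero, frameDet] using this
    rw [h2]
    exact h.det_ne
  have hc : ∀ w, ContinuousAt (fun q : V × E => q.1 ⬝ᵥ fderiv ℝ φ q.2 w) (ψ 0, 0) := fun w =>
    continuousAt_dotProduct continuousAt_fst
      (ContinuousAt.comp (g := fun u => fderiv ℝ φ u w) (h.continuousAt_fderiv w) continuousAt_snd)
  have hσ : ContinuousAt (fun q : V × E => (q.2,
      -((q.1 ⬝ᵥ fderiv ℝ φ q.2 w₀) / (q.1 ⬝ᵥ fderiv ℝ φ q.2 w₁)).re)) (ψ 0, 0) :=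
    continuousAt_snd.prodMk
      (Complex.continuous_re.continuousAt.comp ((hc w₀).div (hc w₁) hbw₁)).neg
  -- The slope `σ` of a critical line `b` at `[φ u]` depends continuously on `(b, u)` and vanishes
  -- at `(ψ 0, 0)`. A product neighbourhood is needed, since `u` is controlled by `U₀` and `b` by
  -- closeness to `d`.
  have hev : ∀ᶠ q in 𝓝 (ψ 0) ×ˢ 𝓝 (0 : E), q.1 ⬝ᵥ fderiv ℝ φ q.2 w₁ ≠ 0 ∧
      (q.2, -((q.1 ⬝ᵥ fderiv ℝ φ q.2 w₀) / (q.1 ⬝ᵥ fderiv ℝ φ q.2 w₁)).re) ∈ B := by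
    rw [← nhds_prod_eq]
    refine ((hc w₁).eventually_ne hbw₁).and (hσ.preimage_mem_nhds ?_)
    simpa [hbw₀] using (show B ∈ 𝓝 ((0 : E), (0 : ℝ)) from hB)
  obtain ⟨P, hP, Q, hQ, hPQ⟩ := eventually_prod_iff.1 hev
  obtain ⟨U₀, hU₀, h0, hdual⟩ := h.param.exists_conormal_of_mem_dual (hQ.and h.eventually_isGood)
  refine ⟨U₀, hU₀.mem_nhds ((mem_iff_of_mem_cone_singleton h.point).1 h0), fun U hU hUo hzU => ?_⟩
  refine eventually_iff_of_cone h.line ?_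
  have hφU : ∀ᶠ u in 𝓝 (0 : E), φ u ∈ cone U :=
    h.contDiff.continuousAt.eventually ((isOpen_cone hUo).mem_nhds
      ((mem_iff_of_mem_cone_singleton h.point).2 hzU))
  have hsurj := hH.surj _ ((continuousAt_fst (p := (0 : E × ℝ))).eventually
    (h.eventually_isGood.and hφU))
  filter_upwards [hP, hsurj] with b hbP hbs
  constructor
  · intro hbd
    have hb0 := ne_zero_of_mem_cone hbd
    obtain ⟨u, ⟨huQ, hu⟩, -, hcon⟩ := hdual U hU hUo b hbd
    obtain ⟨h1, h2⟩ := hPQ hbP huQ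
    obtain ⟨c, hc, hbc⟩ := hcon.exists_smul_dualParam (w₀ := w₀) hb0 h.indep
      (ne_zero_of_mem_cone hu.param.mem.self_of_nhds) hu.param.imm h1
    refine ⟨hb0, _, h2, ?_⟩
    rw [← smul_mem_cone_iff hc, ← hbc]
    exact ⟨hb0, rfl⟩
  · intro hbH
    have hb0 := ne_zero_of_mem_cone hbH
    obtain ⟨p, ⟨hp, hpU⟩, c, hc, rfl⟩ := hbs hbH
    rw [smul_mem_cone_iff hc]
    exact (hp.param.inter hUo hpU).mem_cone_dual (smul_ne_zero_iff.1 hb0).2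
      (isConormal_of_dualParam h.finrank_eq h.indep hp.det_ne)

end

/-! ### Dependence on germs only, and the conclusion -/

theorem IsRegularPair.exists_dual {S : Set P2} {z d : P2} (h : IsRegularPair S z d) :
    ∃ H : Set P2, IsDualGerm S z d H ∧ IsSubmanifoldAt 1 3 H d ∧ IsDualGerm H d z S ∧
      ∀ x, IsCritical H d x ↔ x = z := by
  obtain ⟨φ, w₀, w₁, hf⟩ := h.exists_dualFrame
  obtain ⟨H, hH, hg⟩ := hf.exists_isDualGerm
  exact ⟨H, hg, hH.isSubmanifoldAt (by simp) hf.line, hf.isDualGerm_dual hH, hf.isCritical_iff hH⟩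

theorem IsDualGerm.eventually_iff {N M M' : Set P2} {z d : P2} (h : IsDualGerm N z d M)
    (h' : IsDualGerm N z d M') : ∀ᶠ x in 𝓝 d, (x ∈ M ↔ x ∈ M') := by
  obtain ⟨U₀, hU₀, h1⟩ := h
  obtain ⟨U₁, hU₁, h2⟩ := h'
  obtain ⟨U, hU, hUo, hz⟩ := mem_nhds_iff.1 (inter_mem hU₀ hU₁)
  filter_upwards [h1 U (hU.trans Set.inter_subset_left) hUo hz,
    h2 U (hU.trans Set.inter_subset_right) hUo hz] with x hx1 hx2
  exact hx1.symm.trans hx2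

theorem IsDualGerm.congr {N N' M : Set P2} {z d : P2} (h : IsDualGerm N z d M)
    (hN : ∀ᶠ x in 𝓝 z, (x ∈ N ↔ x ∈ N')) : IsDualGerm N' z d M := by
  obtain ⟨U₀, hU₀, h1⟩ := h
  refine ⟨_, inter_mem hU₀ hN, fun U hU hUo hz => ?_⟩
  have h2 : N' ∩ U = N ∩ U := by
    ext x
    exact and_congr_left fun hx => (hU hx).2.symm
  rw [h2]
  exact h1 U (hU.trans Set.inter_subset_left) hUo hz

theorem tangentLift_le_of_eventually {N N' : Set P2} {z : P2}
    (hN : ∀ᶠ x in 𝓝 z, (x ∈ N ↔ x ∈ N')) : tangentLift N z ≤ tangentLift N' z := by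
  refine Submodule.span_mono ?_
  rintro w ⟨γ, h0, hd, hγ⟩
  refine ⟨γ, h0, hd, ?_⟩
  have h1 := (eventually_nhds_iff_cone (rep_mem_cone_iff.2 rfl)).1 hN
  rw [← h0] at h1
  filter_upwards [hγ, hd.continuousAt.eventually h1] with t ht1 ht2
  exact ⟨ht1.1, ht2.2.1 ht1.2⟩

theorem IsCritical.congr {N N' : Set P2} {z d : P2} (h : IsCritical N z d)
    (hN : ∀ᶠ x in 𝓝 z, (x ∈ N ↔ x ∈ N')) : IsCritical N' z d := by
  have h1 : tangentLift N z = tangentLift N' z :=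
    le_antisymm (tangentLift_le_of_eventually hN)
      (tangentLift_le_of_eventually (hN.mono fun _ h => h.symm))
  exact ⟨hN.self_of_nhds.1 h.1, h.2.1, h1 ▸ h.2.2⟩

end RealDuality

theorem mainTheorem6 :
    (∀ (S : Set RealDuality.P2) (z₀ d₀ : RealDuality.P2),
      RealDuality.IsRegularPair S z₀ d₀ →
        ∃ H : Set RealDuality.P2,
          RealDuality.IsDualGerm S z₀ d₀ H ∧
          RealDuality.IsSubmanifoldAt 1 3 H d₀ ∧
          RealDuality.IsDualGerm H d₀ z₀ S) ∧
    (∀ (S S' : Set RealDuality.P2) (z₀ z₀' d₀ : RealDuality.P2),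
      RealDuality.IsRegularPair S z₀ d₀ → RealDuality.IsRegularPair S' z₀' d₀ →
        (∃ H : Set RealDuality.P2,
          RealDuality.IsDualGerm S z₀ d₀ H ∧ RealDuality.IsDualGerm S' z₀' d₀ H) →
        z₀ = z₀' ∧ ∀ᶠ x in 𝓝 z₀, (x ∈ S ↔ x ∈ S')) := by
  refine ⟨fun S z₀ d₀ h => ?_, fun S S' z₀ z₀' d₀ h h' ⟨H, hH, hH'⟩ => ?_⟩
  · obtain ⟨H, h1, h2, h3, -⟩ := h.exists_dual
    exact ⟨H, h1, h2, h3⟩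
  · obtain ⟨H₁, h1, -, h3, h4⟩ := h.exists_dual
    obtain ⟨H₂, h1', -, h3', h4'⟩ := h'.exists_dual
    have h5 : ∀ᶠ x in 𝓝 d₀, (x ∈ H₁ ↔ x ∈ H₂) := by
      filter_upwards [h1.eventually_iff hH, h1'.eventually_iff hH'] with x hx hx'
      exact hx.trans hx'.symm
    -- Criticality depends only on the germ of the hypersurface at `d₀`, whose unique critical line
    -- there is the base point of the surface.
    have h6 : z₀ = z₀' := (h4' z₀).1 (((h4 z₀).2 rfl).congr h5)
    subst h6
    exact ⟨rfl, (h3.congr h5).eventually_iff h3'⟩
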